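/- Let $A$ be a (not necessarily unital) complex C*-algebra. For $a,b\in A$ write $a\perp b$ if $ab^*=0$ and $ab=0$; for $T\subseteq A$ put $T^\perp=\{s\in A: t\perp s \text{ for all } t\in T\}$. The annihilators of $A$ are the sets $T^\perp$, $T\subseteq A$. Ordered by inclusion and with orthocomplement $B\mapsto B^\perp$ they form a complete ortholattice $\mathbb P=[A]^\perp$. On any complete ortholattice $\mathbb P$, let $p\perp q$ mean $p\le q^\perp$, and let $[p]=\{q\in\mathbb P:q\le p\}$, with the order and the relation $\perp$ of $\mathbb P$. Elements $s,t$ commute if $p\wedge(q\vee r)=(p\wedge q)\vee(p\wedge r)$ and $p\vee(q\wedge r)=(p\vee q)\wedge(p\vee r)$ for all $p,q,r\in\{s,s^\perp,t,t^\perp\}$; $p$ is central if it commutes with every element; the central cover $\mathrm c(p)$ is the infimum of the central elements above $p$; $p,q$ are very orthogonal if $\mathrm c(p)\perp\mathrm c(q)$. A set $T\subseteq\mathbb P$ is a type ideal if, for all pairwise very orthogonal $S\subseteq\mathbb P$, $S\subseteq T\Leftrightarrow\bigvee S\in T$. Let $D$, $M$, $O$ be the sets of $p\in\mathbb P$ for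 which the lattice $[p]$ is, respectively, distributive, modular, orthomodular (the last meaning that $r\wedge(s\vee t)=s\vee(r\wedge t)$ for all $r,s,t\in[p]$ with $s\le r$ and $s\perp t$). For $T\in\{D,M,O\}$ put $q_T=\bigvee\{\mathrm c(t):t\in T\}$, and set $$A_{\mathrm I}=q_D,\quad A_{\mathrm{II}}=q_D^\perp\wedge q_M,\quad A_{\mathrm{III}}=q_M^\perp\wedge q_O,\quad A_{\mathrm{IV}}=q_O^\perp .$$ **Theorem.** (1) For every C*-algebra $A$, the sets $D$, $M$, $O$ are type ideals of $[A]^\perp$, and for each $T\in\{D,M,O\}$, $q_T$ is the unique central $q\in[A]^\perp$ such that $q=\mathrm c(t)$ for some $t\in T$ and $[q^\perp]\cap T=\{\mathbf 0\}$. The annihilators $A_{\mathrm I},A_{\mathrm{II}},A_{\mathrm{III}},A_{\mathrm{IV}}$ are closed two-sided ideals of $A$ and are pairwise orthogonal, their sum is direct, and $E=A_{\mathrm I}\oplus A_{\mathrm{II}}\oplus A_{\mathrm{III}}\oplus A_{\mathrm{IV}}$ is a closed two-sided ideal of $A$ that is essential, i.e. $E^{\perp\perp}=A$. (2) If $A$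 is a von Neumann algebra on a complex Hilbert space, there are pairwise orthogonal central projections $z_1,z_2,z_3\in A$ with sum $1$ such that $z_1A$ is of type I, $z_2A$ is of type II and $z_3A$ is of type III in the classical sense (a summand being allowed to be zero), with $A_{\mathrm I}=z_1A$, $A_{\mathrm{II}}=z_2A$, $A_{\mathrm{III}}=z_3A$ and $A_{\mathrm{IV}}=\{0\}$. Here $zA$ is of type I if every nonzero central projection below $z$ majorizes a nonzero abelian projection; of type II if there is no nonzero abelian projection below $z$ and every nonzero central projection below $z$ majorizes a nonzero finite projection; of type III if there is no nonzero finite projection below $z$. -/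

import Mathlib

/-- A complete ortholattice: a complete lattice with an antitone involutive complementation. -/
class CompleteOrtholattice (P : Type*) extends CompleteLattice P, Compl P where
  compl_antitone' : ∀ p q : P, p ≤ q → qᶜ ≤ pᶜ
  compl_involutive' : ∀ p : P, pᶜᶜ = p
  inf_compl_bot' : ∀ p : P, p ⊓ pᶜ = ⊥
  sup_compl_top' : ∀ p : P, p ⊔ pᶜ = ⊤

namespace CompleteOrtholattice

section Basic

variable {P : Type*} [CompleteOrtholattice P]

/-- Orthogonality in an ortholattice. -/
def Orth (p q : P) : Prop := p ≤ qᶜ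

/-- `s` and `t` commute: both distributive laws hold for all triples from `{s, sᶜ, t, tᶜ}`. -/
def Commutes (s t : P) : Prop :=
  ∀ p ∈ ({s, sᶜ, t, tᶜ} : Set P), ∀ q ∈ ({s, sᶜ, t, tᶜ} : Set P),
    ∀ r ∈ ({s, sᶜ, t, tᶜ} : Set P),
      p ⊓ (q ⊔ r) = (p ⊓ q) ⊔ (p ⊓ r) ∧ p ⊔ (q ⊓ r) = (p ⊔ q) ⊓ (p ⊔ r)

/-- `p` is central if it commutes with every element. -/
def IsCentral (p : P) : Prop := ∀ q : P, Commutes p q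

/-- The central cover of `p`: the infimum of all central elements above `p`. -/
def centralCover (p : P) : P := sInf {q : P | p ≤ q ∧ IsCentral q}

def VeryOrth (p q : P) : Prop := Orth (centralCover p) (centralCover q)

/-- A type ideal: a set `T` such that, for pairwise very orthogonal `S`,
`S ⊆ T` if and only if `⋁ S ∈ T`. -/
def IsTypeIdeal (T : Set P) : Prop :=
  ∀ S : Set P, S.Pairwise VeryOrth → (S ⊆ T ↔ sSup S ∈ T)

/-- The properties that single out the central element `q_T` attached to `T`: it is central, it is
the central cover of an element of `T`, and the only element of `T` below its complement is `⊥`. -/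
def IsTypeCover (T : Set P) (q : P) : Prop :=
  IsCentral q ∧ q ∈ centralCover '' T ∧ Set.Iic qᶜ ∩ T = {⊥}

/-- The element `q_T`, the join of the central covers of the elements of `T`. -/
def typeCover (T : Set P) : P := sSup (centralCover '' T)

end Basic

/-- Both distributive laws hold in the lattice `L`. -/
def IsDistributive (L : Type*) [Lattice L] : Prop :=
  ∀ p q r : L, p ⊓ (q ⊔ r) = (p ⊓ q) ⊔ (p ⊓ r) ∧ p ⊔ (q ⊓ r) = (p ⊔ q) ⊓ (p ⊔ r)

/-- Orthomodularity of a lattice `L` with an orthogonality relation `perp`, stated without using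
an orthocomplementation. -/
def IsOrthomodular (L : Type*) [Lattice L] (perp : L → L → Prop) : Prop :=
  ∀ p q r : L, q ≤ p → perp q r → p ⊓ (q ⊔ r) = q ⊔ (p ⊓ r)

section Types

variable (P : Type*) [CompleteOrtholattice P]

/-- The `p` for which the lattice `[p] = {q | q ≤ p}` is distributive. -/
def distributiveElements : Set P := {p | IsDistributive (Set.Iic p)}

/-- The `p` for which the lattice `[p] = {q | q ≤ p}` is modular. -/
def modularElements : Set P := {p | IsModularLattice (Set.Iic p)}

/-- The `p` for which the lattice `[p] = {q | q ≤ p}`, with the orthogonality relation of `P`,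
is orthomodular. -/
def orthomodularElements : Set P :=
  {p | IsOrthomodular (Set.Iic p) (fun q r => Orth (q : P) (r : P))}

def typeI : P := typeCover (distributiveElements P)

def typeII : P := (typeCover (distributiveElements P))ᶜ ⊓ typeCover (modularElements P)

def typeIII : P := (typeCover (modularElements P))ᶜ ⊓ typeCover (orthomodularElements P)

def typeIV : P := (typeCover (orthomodularElements P))ᶜ

end Types

end CompleteOrtholattice

section Annihilators

/-- The relation `a ⊥ b` on a `*`-ring: `a b* = 0` and `a b = 0`. -/
def StarPerp {A : Type*} [NonUnitalNormedRing A] [StarRing A] (a b : A) : Prop :=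
  a * star b = 0 ∧ a * b = 0

/-- `T^⊥ = {s | ∀ t ∈ T, t ⊥ s}`. -/
def perpSet {A : Type*} [NonUnitalNormedRing A] [StarRing A] (T : Set A) : Set A :=
  {s | ∀ t ∈ T, StarPerp t s}

/-- The annihilators of `A`, i.e. the sets of the form `T^⊥` with `T ⊆ A`. -/
def Annihilator (A : Type*) [NonUnitalNormedRing A] [StarRing A] : Type _ :=
  {B : Set A // ∃ T : Set A, perpSet T = B}

namespace Annihilator

variable {A : Type*} [NonUnitalNormedRing A] [StarRing A]

/-- The underlying set of an annihilator. -/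
def carrier (B : Annihilator A) : Set A := B.1

theorem carrier_injective : Function.Injective (carrier : Annihilator A → Set A) :=
  Subtype.val_injective

theorem star_mem_perpSet {T : Set A} {s : A} (h : s ∈ perpSet T) : star s ∈ perpSet T :=
  fun t ht => ⟨by simpa using (h t ht).2, (h t ht).1⟩

theorem perpSet_antitone {S T : Set A} (h : S ⊆ T) : perpSet T ⊆ perpSet S :=
  fun _ hs t ht => hs t (h ht)

theorem subset_perpSet_perpSet {B : Set A} (hB : ∀ b ∈ B, star b ∈ B) :
    B ⊆ perpSet (perpSet B) := by
  intro b hb x hx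
  have key : ∀ c ∈ B, x * star c = 0 := by
    intro c hc
    have := congrArg star (hx c hc).1
    simpa using this
  exact ⟨key b hb, by simpa using key (star b) (hB b hb)⟩

theorem perpSet_perpSet_perpSet [CStarRing A] (T : Set A) :
    perpSet (perpSet (perpSet T)) = perpSet T := by
  apply Set.Subset.antisymm
  · intro s hs t ht
    have hmem : star t * t ∈ perpSet (perpSet T) := by
      intro x hx
      have hxt : x * star t = 0 := by
        have := congrArg star (hx t ht).1
        simpa using this
      constructor
      · simp [← mul_assoc, hxt]
      · simp [← mul_assoc, hxt]
    have key : ∀ y : A, star t * t * y = 0 → t * y = 0 := by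
      intro y hy
      rw [← CStarRing.star_mul_self_eq_zero_iff, star_mul, mul_assoc, ← mul_assoc (star t), hy,
        mul_zero]
    exact ⟨key _ (hs _ hmem).1, key _ (hs _ hmem).2⟩
  · exact subset_perpSet_perpSet fun _ h => star_mem_perpSet h

/-- The annihilator `T^⊥` of a set `T`. -/
def ofPerp (T : Set A) : Annihilator A := ⟨perpSet T, T, rfl⟩

theorem perpSet_perpSet_carrier [CStarRing A] (B : Annihilator A) :
    perpSet (perpSet B.carrier) = B.carrier := by
  obtain ⟨_, T, rfl⟩ := B
  exact perpSet_perpSet_perpSet T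

/-- Annihilators are ordered by inclusion. -/
instance : PartialOrder (Annihilator A) := PartialOrder.lift carrier carrier_injective

/-- The infimum of a family of annihilators is their intersection. -/
instance : InfSet (Annihilator A) :=
  ⟨fun S => ⟨{a | ∀ B ∈ S, a ∈ B.carrier}, ⋃ B ∈ S, B.2.choose, by
    ext a
    have h : ∀ B : Annihilator A, a ∈ B.carrier ↔ a ∈ perpSet B.2.choose := fun B => by
      rw [B.2.choose_spec]; rfl
    simp only [Set.mem_ofPred_eq, h]
    constructor
    · intro ha B hB t ht
      exact ha t (Set.mem_biUnion hB ht)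
    · intro ha t ht
      obtain ⟨B, hB, htB⟩ := Set.mem_iUnion₂.1 ht
      exact ha B hB t htB⟩⟩

/-- The complete lattice of annihilators: all infima are intersections. -/
instance : CompleteLattice (Annihilator A) :=
  completeLatticeOfInf (Annihilator A) fun _ =>
    ⟨fun B hB _ ha => ha B hB, fun _ hC _ ha B hB => hC hB ha⟩

/-- The complete ortholattice of annihilators of `A`, with orthocomplement `B ↦ B^⊥`. -/
instance [CStarRing A] : CompleteOrtholattice (Annihilator A) :=
  { (inferInstance : CompleteLattice (Annihilator A)) with
    compl := fun B => ofPerp B.carrier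
    compl_antitone' := fun _ _ h => perpSet_antitone h
    compl_involutive' := fun B => carrier_injective (perpSet_perpSet_carrier B)
    inf_compl_bot' := by
      intro B
      rw [eq_bot_iff]
      intro a ha
      have h1 : a ∈ B.carrier := (inf_le_left : B ⊓ ofPerp B.carrier ≤ B) ha
      have h2 : a ∈ perpSet B.carrier :=
        (inf_le_right : B ⊓ ofPerp B.carrier ≤ ofPerp B.carrier) ha
      have h3 : a = 0 := CStarRing.mul_star_self_eq_zero_iff a |>.1 (h2 a h1).1
      subst h3
      obtain ⟨T, hT⟩ := (⊥ : Annihilator A).2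
      change (0 : A) ∈ (⊥ : Annihilator A).1
      rw [← hT]
      intro t _
      simp [StarPerp]
    sup_compl_top' := by
      intro B
      rw [eq_top_iff]
      intro a _
      have h1 : perpSet (B ⊔ ofPerp B.carrier).carrier ⊆ perpSet B.carrier :=
        perpSet_antitone (le_sup_left : B ≤ B ⊔ ofPerp B.carrier)
      have h2 : perpSet (B ⊔ ofPerp B.carrier).carrier ⊆ perpSet (perpSet B.carrier) :=
        perpSet_antitone (le_sup_right : ofPerp B.carrier ≤ B ⊔ ofPerp B.carrier)
      rw [← perpSet_perpSet_carrier]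
      intro x hx
      have h3 : x = 0 := CStarRing.mul_star_self_eq_zero_iff x |>.1 (h2 hx x (h1 hx)).1
      subst h3
      simp [StarPerp] }

end Annihilator

/-- A closed two-sided ideal of a C*-algebra. -/
structure IsClosedIdeal {A : Type*} [NonUnitalCStarAlgebra A] (I : Set A) : Prop where
  zero_mem : (0 : A) ∈ I
  add_mem : ∀ a ∈ I, ∀ b ∈ I, a + b ∈ I
  smul_mem : ∀ (c : ℂ), ∀ a ∈ I, c • a ∈ I
  mul_mem_left : ∀ (x : A), ∀ a ∈ I, x * a ∈ I
  mul_mem_right : ∀ (x : A), ∀ a ∈ I, a * x ∈ I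
  isClosed : IsClosed I

/-- A set `T` is essential if `T^⊥⊥` is the whole algebra. -/
def IsEssential {A : Type*} [NonUnitalNormedRing A] [StarRing A] (T : Set A) : Prop :=
  perpSet (perpSet T) = Set.univ

/-- The set of sums `∑ i, f i` with `f i ∈ B i`. -/
def sumSet {A : Type*} [AddCommMonoid A] {ι : Type*} [Fintype ι] (B : ι → Set A) : Set A :=
  {a | ∃ f : ι → A, (∀ i, f i ∈ B i) ∧ ∑ i, f i = a}

/-- The sum of the sets `B i` is direct: the summands of `∑ i, f i` with `f i ∈ B i` are
determined by the sum. -/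
def IsDirect {A : Type*} [AddCommMonoid A] {ι : Type*} [Fintype ι] (B : ι → Set A) : Prop :=
  ∀ f g : ι → A, (∀ i, f i ∈ B i) → (∀ i, g i ∈ B i) → ∑ i, f i = ∑ i, g i → f = g

/-- The four parts `A_I`, `A_II`, `A_III`, `A_IV` of `A`. -/
noncomputable def typePart (A : Type*) [NonUnitalNormedRing A] [StarRing A] [CStarRing A] :
    Fin 4 → Annihilator A :=
  ![CompleteOrtholattice.typeI (Annihilator A), CompleteOrtholattice.typeII (Annihilator A),
    CompleteOrtholattice.typeIII (Annihilator A), CompleteOrtholattice.typeIV (Annihilator A)]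

end Annihilators

section Classical

/-- A von Neumann algebra is a C*-ring in the operator norm. -/
instance VonNeumannAlgebra.instCStarRing {H : Type*} [NormedAddCommGroup H]
    [InnerProductSpace ℂ H] [CompleteSpace H] (M : VonNeumannAlgebra H) : CStarRing M where
  norm_mul_self_le x := (CStarRing.norm_star_mul_self (x := (x : H →L[ℂ] H))).symm.le

namespace Projections

variable {M : Type*} [Ring M] [StarRing M]

/-- The order on projections: `p ≤ q` iff `p = p q`. -/
def Below (p q : M) : Prop := p = p * q

def IsCentralProjection (z : M) : Prop := IsStarProjection z ∧ ∀ a : M, z * a = a * z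

/-- A projection `e` is abelian if the corner `eMe` is commutative. -/
def IsAbelian (e : M) : Prop :=
  ∀ a b : M, (e * a * e) * (e * b * e) = (e * b * e) * (e * a * e)

/-- Murray-von Neumann equivalence. -/
def MvNEquiv (e f : M) : Prop := ∃ v : M, star v * v = e ∧ v * star v = f

/-- A projection is finite if it is not Murray-von Neumann equivalent to a proper
subprojection. -/
def IsFinite (e : M) : Prop := ∀ f : M, IsStarProjection f → Below f e → MvNEquiv e f → f = e

/-- The direct summand of the central projection `z` is of type I: every nonzero central projection
below `z` majorizes a nonzero abelian projection. -/
def IsTypeI (z : M) : Prop :=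
  ∀ w : M, IsCentralProjection w → Below w z → w ≠ 0 →
    ∃ e : M, IsStarProjection e ∧ Below e w ∧ e ≠ 0 ∧ IsAbelian e

/-- The direct summand of the central projection `z` is of type II: there is no nonzero abelian
projection below `z`, and every nonzero central projection below `z` majorizes a nonzero finite
projection. -/
def IsTypeII (z : M) : Prop :=
  (∀ e : M, IsStarProjection e → Below e z → IsAbelian e → e = 0) ∧
  ∀ w : M, IsCentralProjection w → Below w z → w ≠ 0 →
    ∃ e : M, IsStarProjection e ∧ Below e w ∧ e ≠ 0 ∧ IsFinite e

/-- The direct summand of the central projection `z` is of type III: there is no nonzero finite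
projection below `z`. -/
def IsTypeIII (z : M) : Prop :=
  ∀ e : M, IsStarProjection e → Below e z → IsFinite e → e = 0

/-- `z₁`, `z₂`, `z₃` are the central projections of the classical type decomposition. -/
def IsClassicalTypeDecomposition (z₁ z₂ z₃ : M) : Prop :=
  IsCentralProjection z₁ ∧ IsCentralProjection z₂ ∧ IsCentralProjection z₃ ∧
  z₁ * z₂ = 0 ∧ z₁ * z₃ = 0 ∧ z₂ * z₃ = 0 ∧ z₁ + z₂ + z₃ = 1 ∧
  IsTypeI z₁ ∧ IsTypeII z₂ ∧ IsTypeIII z₃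

end Projections

end Classical

/-!
The proof has a lattice-theoretic part, a part that locates the centre of `[A]^⊥`, and a part on
projections in von Neumann algebras.

*Lattices.* Suppose that the centre of a complete ortholattice is closed under joins and that meets
distribute over joins of central elements (`HasContinuousCenter`). Then an inequality below a join
of central elements can be checked on each of them, so each hereditary lattice property that is
given by inequalities defines a type ideal. In a type ideal `T` a maximal very orthogonal family has
a join whose central cover is the largest possible, namely `typeCover T`
(`exists_centralCover_eq_typeCover`); this gives the characterization of `q_T`.

*Annihilators.* The hypotheses hold in `[A]^⊥` because its central elements are the annihilators
that are ideals (`isCentral_iff_isIdeal`). If `BAB^⊥ ≠ 0`, then the absolute value of an element of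
this set yields an annihilator that meets both `B` and `B^⊥` trivially (`exists_inf_eq_bot`), so `B`
does not split it. Conversely, meets distribute over joins of ideals (`inf_sSup_le_of_mul_mem`),
since `X C X ⊆ X ∩ C` for an ideal `C`. The sum of the four parts is closed as the components of a
sum of orthogonal elements are bounded by the sum.

*Von Neumann algebras.* Annihilators are the corners `eMe` of projections `e`. The lattice below
`eMe` is always orthomodular, so `A_IV = 0`. It is distributive iff `e` is abelian: by
`exists_inf_eq_bot`, distributivity makes all projections below `e` central in `eMe`, and an
element of `eMe` that commutes with all projections commutes with everything by the binary expansion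
of positive contractions (`norm_commutator_le`). It is modular iff `e` is finite: by polar
decomposition and the parallelogram law two comparable projections with a common relative complement
are equivalent (`corner_mem_modularElements`), while a proper isometry in `eMe` yields a pentagon
that consists of two comparable projections and the graph of an operator
(`isFinite_of_corner_mem_modularElements`). Hence the parts of `[M]^⊥` have the defining properties
of the classical summands.
-/

namespace CompleteOrtholattice

variable {P : Type*} [CompleteOrtholattice P]

/-! ### Orthocomplements -/

theorem compl_le_compl {p q : P} (h : p ≤ q) : qᶜ ≤ pᶜ := compl_antitone' p q h

@[simp] theorem compl_compl (p : P) : pᶜᶜ = p := compl_involutive' p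

@[simp] theorem inf_compl_self (p : P) : p ⊓ pᶜ = ⊥ := inf_compl_bot' p

@[simp] theorem compl_inf_self (p : P) : pᶜ ⊓ p = ⊥ := by rw [inf_comm, inf_compl_self]

@[simp] theorem sup_compl_self (p : P) : p ⊔ pᶜ = ⊤ := sup_compl_top' p

@[simp] theorem compl_sup_self (p : P) : pᶜ ⊔ p = ⊤ := by rw [sup_comm, sup_compl_self]

theorem le_compl_comm {p q : P} : p ≤ qᶜ ↔ q ≤ pᶜ :=
  ⟨fun h => by simpa using compl_le_compl h, fun h => by simpa using compl_le_compl h⟩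

theorem compl_sSup (S : Set P) : (sSup S)ᶜ = sInf ((·ᶜ) '' S) := by
  apply le_antisymm
  · refine le_sInf ?_
    rintro _ ⟨s, hs, rfl⟩
    exact compl_le_compl (le_sSup hs)
  · rw [le_compl_comm]
    refine sSup_le fun s hs => ?_
    rw [le_compl_comm]
    exact sInf_le ⟨s, hs, rfl⟩

theorem compl_sup (p q : P) : (p ⊔ q)ᶜ = pᶜ ⊓ qᶜ := by
  rw [← sSup_pair, compl_sSup, Set.image_pair, sInf_pair]

theorem compl_inf (p q : P) : (p ⊓ q)ᶜ = pᶜ ⊔ qᶜ := by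
  rw [← compl_compl (pᶜ ⊔ qᶜ), compl_sup, compl_compl, compl_compl]

@[simp] theorem compl_top : (⊤ : P)ᶜ = ⊥ := by simpa using inf_compl_self (⊤ : P)

theorem le_bot_of_le_compl {p q : P} (h : p ≤ q) (h' : p ≤ qᶜ) : p = ⊥ :=
  le_bot_iff.1 ((le_inf h h').trans (inf_compl_self q).le)

theorem Orth.symm {p q : P} (h : Orth p q) : Orth q p := le_compl_comm.1 h

theorem Orth.mono {p q p' q' : P} (h : Orth p q) (hp : p' ≤ p) (hq : q' ≤ q) : Orth p' q' :=
  hp.trans (h.trans (compl_le_compl hq))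

/-! ### Central elements -/

theorem IsCentral.compl {c : P} (hc : IsCentral c) : IsCentral cᶜ := by
  intro q p hp x hx y hy
  have h : ({cᶜ, cᶜᶜ, q, qᶜ} : Set P) ⊆ {c, cᶜ, q, qᶜ} := by
    rw [compl_compl]
    intro a
    simp only [Set.mem_insert_iff, Set.mem_singleton_iff]
    tauto
  exact hc q p (h hp) x (h hx) y (h hy)

theorem IsCentral.inf_sup_inf_compl {c : P} (hc : IsCentral c) (x : P) :
    x = (x ⊓ c) ⊔ (x ⊓ cᶜ) := by
  have := (hc x x (by simp) c (by simp) cᶜ (by simp)).1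
  rwa [sup_compl_self, inf_top_eq] at this

theorem IsCentral.inf_le_iff {c : P} (hc : IsCentral c) {x y : P} :
    c ⊓ x ≤ y ↔ x ≤ cᶜ ⊔ y := by
  constructor
  · intro h
    rw [hc.inf_sup_inf_compl x]
    exact sup_le (le_sup_of_le_right (inf_comm c x ▸ h)) (le_sup_of_le_left inf_le_right)
  · intro h
    have := (hc y c (by simp) cᶜ (by simp) y (by simp)).1
    calc c ⊓ x ≤ c ⊓ (cᶜ ⊔ y) := inf_le_inf_left _ h
      _ = c ⊓ y := by rw [this, inf_compl_self, bot_sup_eq]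
      _ ≤ y := inf_le_right

theorem IsCentral.gc {c : P} (hc : IsCentral c) :
    GaloisConnection (fun x => c ⊓ x) (fun y => cᶜ ⊔ y) := fun _ _ => hc.inf_le_iff

theorem IsCentral.inf_sup {c : P} (hc : IsCentral c) (x y : P) :
    c ⊓ (x ⊔ y) = (c ⊓ x) ⊔ (c ⊓ y) := hc.gc.l_sup

theorem IsCentral.sup_inf {c : P} (hc : IsCentral c) (x y : P) :
    (x ⊔ y) ⊓ c = (x ⊓ c) ⊔ (y ⊓ c) := by
  simpa only [inf_comm] using hc.inf_sup x y

/-- An element `c` is central as soon as it splits every other element. The lattice then embeds into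
`[c] × [cᶜ]`, where `c`, `cᶜ` become the bounds of the factors and `t`, `tᶜ` become complements in
each factor, so that the four of them satisfy both distributive laws. -/
theorem isCentral_of_le {c : P} (h : ∀ x : P, x ≤ (x ⊓ c) ⊔ (x ⊓ cᶜ)) : IsCentral c := by
  have h' : ∀ x : P, x ≤ (x ⊓ cᶜ) ⊔ (x ⊓ cᶜᶜ) := fun x => by
    rw [compl_compl, sup_comm]; exact h x
  -- a splitting element distributes over joins
  have key : ∀ d : P, (∀ x : P, x ≤ (x ⊓ d) ⊔ (x ⊓ dᶜ)) → ∀ x y : P,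
      d ⊓ (x ⊔ y) = (d ⊓ x) ⊔ (d ⊓ y) := by
    intro d hd x y
    refine le_antisymm ?_ (sup_le (inf_le_inf_left _ le_sup_left) (inf_le_inf_left _ le_sup_right))
    set w := (d ⊓ x) ⊔ (d ⊓ y) with hw
    have hwd : w ≤ d := sup_le inf_le_left inf_le_left
    have h1 : x ⊔ y ≤ w ⊔ dᶜ := by
      refine sup_le ((hd x).trans ?_) ((hd y).trans ?_)
      · exact sup_le_sup (by rw [inf_comm]; exact le_sup_left) inf_le_right
      · exact sup_le_sup (by rw [inf_comm]; exact le_sup_right) inf_le_right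
    have h2 : d ⊓ (w ⊔ dᶜ) ≤ w := by
      have := compl_le_compl (hd wᶜ)
      rw [compl_sup, compl_inf, compl_inf, compl_compl, compl_compl, sup_eq_right.2 hwd] at this
      rwa [inf_comm]
    exact (inf_le_inf_left _ h1).trans h2
  -- below a splitting element, `t` and `tᶜ` are complementary
  have aux : ∀ d : P, (∀ x y : P, d ⊓ (x ⊔ y) = (d ⊓ x) ⊔ (d ⊓ y)) → ∀ t : P,
      ∀ p ∈ ({d, dᶜ, t, tᶜ} : Set P), ∀ q ∈ ({d, dᶜ, t, tᶜ} : Set P),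
      ∀ r ∈ ({d, dᶜ, t, tᶜ} : Set P),
      d ⊓ (p ⊓ (q ⊔ r)) = d ⊓ ((p ⊓ q) ⊔ (p ⊓ r)) ∧
      d ⊓ (p ⊔ (q ⊓ r)) = d ⊓ ((p ⊔ q) ⊓ (p ⊔ r)) := by
    intro d hd t p hp q hq r hr
    have hinf : ∀ x y : P, d ⊓ (x ⊓ y) = (d ⊓ x) ⊓ (d ⊓ y) := fun x y => inf_inf_distrib_left d x y
    have hu : (d ⊓ t) ⊓ (d ⊓ tᶜ) = ⊥ := by rw [← hinf]; simp
    have hu' : (d ⊓ tᶜ) ⊓ (d ⊓ t) = ⊥ := by rw [inf_comm, hu]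
    have hv : (d ⊓ t) ⊔ (d ⊓ tᶜ) = d := by rw [← hd]; simp
    have hv' : (d ⊓ tᶜ) ⊔ (d ⊓ t) = d := by rw [sup_comm, hv]
    have hall : ∀ x ∈ ({d, dᶜ, t, tᶜ} : Set P),
        d ⊓ x = d ∨ d ⊓ x = ⊥ ∨ d ⊓ x = d ⊓ t ∨ d ⊓ x = d ⊓ tᶜ := by
      simp only [Set.mem_insert_iff, Set.mem_singleton_iff]
      rintro x (rfl | rfl | rfl | rfl) <;> simp
    simp only [hinf, hd]
    have h1 : d ⊓ t ≤ d := inf_le_left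
    have h2 : d ⊓ tᶜ ≤ d := inf_le_left
    generalize d ⊓ t = u at *
    generalize d ⊓ tᶜ = v at *
    rcases hall p hp with h3 | h3 | h3 | h3 <;> rcases hall q hq with h4 | h4 | h4 | h4 <;>
      rcases hall r hr with h5 | h5 | h5 | h5 <;> rw [h3, h4, h5] <;>
      simp [hu, hu', hv, hv', inf_eq_left.2 h1, inf_eq_left.2 h2, inf_eq_right.2 h1,
        inf_eq_right.2 h2, sup_eq_left.2 h1, sup_eq_left.2 h2, sup_eq_right.2 h1, sup_eq_right.2 h2]
  have ext : ∀ x y : P, c ⊓ x = c ⊓ y → cᶜ ⊓ x = cᶜ ⊓ y → x = y := by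
    have : ∀ x y : P, c ⊓ x = c ⊓ y → cᶜ ⊓ x = cᶜ ⊓ y → x ≤ y := fun x y h1 h2 =>
      (h x).trans (sup_le (by rw [inf_comm, h1]; exact inf_le_right)
        (by rw [inf_comm, h2]; exact inf_le_right))
    exact fun x y h1 h2 => le_antisymm (this x y h1 h2) (this y x h1.symm h2.symm)
  intro t p hp q hq r hr
  have hset : ({c, cᶜ, t, tᶜ} : Set P) ⊆ {cᶜ, cᶜᶜ, t, tᶜ} := by
    rw [compl_compl]
    intro a
    simp only [Set.mem_insert_iff, Set.mem_singleton_iff]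
    tauto
  have h1 := aux c (key c h) t p hp q hq r hr
  have h2 := aux cᶜ (key cᶜ h') t p (hset hp) q (hset hq) r (hset hr)
  exact ⟨ext _ _ h1.1 h2.1, ext _ _ h1.2 h2.2⟩

/-- The centre of `P` is closed under joins, and meets distribute over joins of central elements.
This is what makes the decomposition into types work. -/
structure HasContinuousCenter (P : Type*) [CompleteOrtholattice P] : Prop where
  isCentral_sSup : ∀ C : Set P, (∀ c ∈ C, IsCentral c) → IsCentral (sSup C)
  inf_sSup_le : ∀ C : Set P, (∀ c ∈ C, IsCentral c) → ∀ x : P,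
    x ⊓ sSup C ≤ sSup ((x ⊓ ·) '' C)

theorem le_centralCover (p : P) : p ≤ centralCover p := le_sInf fun _ h => h.1

theorem centralCover_le {p c : P} (hc : IsCentral c) (h : p ≤ c) : centralCover p ≤ c :=
  sInf_le ⟨h, hc⟩

theorem centralCover_mono {p q : P} (h : p ≤ q) : centralCover p ≤ centralCover q :=
  sInf_le_sInf fun _ hx => ⟨h.trans hx.1, hx.2⟩

namespace HasContinuousCenter

variable (hP : HasContinuousCenter P)
include hP

theorem isCentral_sInf (C : Set P) (hC : ∀ c ∈ C, IsCentral c) : IsCentral (sInf C) := by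
  have h := hP.isCentral_sSup ((·ᶜ) '' C) (by rintro _ ⟨c, hc, rfl⟩; exact (hC c hc).compl)
  have h2 := h.compl
  rw [compl_sSup, Set.image_image] at h2
  simpa using h2

theorem isCentral_inf {c d : P} (hc : IsCentral c) (hd : IsCentral d) : IsCentral (c ⊓ d) := by
  rw [← sInf_pair]
  refine hP.isCentral_sInf _ ?_
  rintro x (rfl | rfl) <;> assumption

theorem isCentral_centralCover (p : P) : IsCentral (centralCover p) :=
  hP.isCentral_sInf _ fun _ h => h.2

theorem isCentral_typeCover (T : Set P) : IsCentral (typeCover T) :=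
  hP.isCentral_sSup _ (by rintro _ ⟨t, _, rfl⟩; exact hP.isCentral_centralCover t)

/-- An inequality below a join of central elements can be checked on each of them. -/
theorem le_of_forall_inf_le {C : Set P} (hC : ∀ c ∈ C, IsCentral c) {x y : P} (hx : x ≤ sSup C)
    (h : ∀ c ∈ C, x ⊓ c ≤ y) : x ≤ y := by
  have := hP.inf_sSup_le C hC x
  rw [inf_eq_left.2 hx] at this
  refine this.trans (sSup_le ?_)
  rintro _ ⟨c, hc, rfl⟩
  exact h c hc

theorem sSup_inf_centralCover {S : Set P} (hS : S.Pairwise VeryOrth) {s : P} (hs : s ∈ S) :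
    sSup S ⊓ centralCover s = s := by
  refine le_antisymm ?_ (le_inf (le_sSup hs) (le_centralCover s))
  rw [inf_comm, (hP.isCentral_centralCover s).inf_le_iff]
  refine sSup_le fun t ht => ?_
  by_cases hts : t = s
  · exact hts ▸ le_sup_right
  · exact le_sup_of_le_left ((le_centralCover t).trans (hS ht hs hts))

/-- A set of elements is a type ideal if it is hereditary and membership can be checked on the
pieces cut out by central elements. -/
theorem isTypeIdeal_of_local {T : Set P} (hT : ∀ s t, s ≤ t → t ∈ T → s ∈ T)
    (hloc : ∀ (e : P) (C : Set P), (∀ c ∈ C, IsCentral c) → e ≤ sSup C →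
      (∀ c ∈ C, e ⊓ c ∈ T) → e ∈ T) : IsTypeIdeal T := by
  intro S hS
  constructor
  · intro hST
    refine hloc (sSup S) (centralCover '' S) ?_ ?_ ?_
    · rintro _ ⟨s, _, rfl⟩
      exact hP.isCentral_centralCover s
    · exact sSup_le fun s hs => (le_centralCover s).trans (le_sSup ⟨s, hs, rfl⟩)
    · rintro _ ⟨s, hs, rfl⟩
      rw [hP.sSup_inf_centralCover hS hs]
      exact hST hs
  · exact fun h s hs => hT s _ (le_sSup hs) h

end HasContinuousCenter

/-! ### Distributive, modular and orthomodular elements -/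

theorem mem_distributiveElements {e : P} : e ∈ distributiveElements P ↔
    ∀ p q r : P, p ≤ e → q ≤ e → r ≤ e → p ⊓ (q ⊔ r) ≤ (p ⊓ q) ⊔ (p ⊓ r) := by
  constructor
  · intro h p q r hp hq hr
    exact le_of_eq (congrArg Subtype.val (h ⟨p, hp⟩ ⟨q, hq⟩ ⟨r, hr⟩).1)
  · intro h
    let _ : DistribLattice (Set.Iic e) := DistribLattice.ofInfSupLe
      (fun p q r => h p.1 q.1 r.1 p.2 q.2 r.2)
    exact fun p q r => ⟨inf_sup_left p q r, sup_inf_left p q r⟩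

theorem mem_modularElements {e : P} : e ∈ modularElements P ↔
    ∀ p q r : P, p ≤ e → q ≤ e → r ≤ e → p ≤ r → (p ⊔ q) ⊓ r ≤ p ⊔ (q ⊓ r) := by
  constructor
  · intro h p q r hp hq hr hpr
    exact h.sup_inf_le_assoc_of_le (x := ⟨p, hp⟩) ⟨q, hq⟩ (z := ⟨r, hr⟩) hpr
  · exact fun h => ⟨fun {x} y {z} hxz => h x.1 y.1 z.1 x.2 y.2 z.2 hxz⟩

theorem mem_orthomodularElements {e : P} : e ∈ orthomodularElements P ↔
    ∀ p q r : P, p ≤ e → q ≤ e → r ≤ e → q ≤ p → Orth q r → p ⊓ (q ⊔ r) ≤ q ⊔ (p ⊓ r) := by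
  constructor
  · intro h p q r hp hq hr hqp hqr
    exact le_of_eq (congrArg Subtype.val (h ⟨p, hp⟩ ⟨q, hq⟩ ⟨r, hr⟩ hqp hqr))
  · intro h p q r hqp hqr
    refine le_antisymm (h p.1 q.1 r.1 p.2 q.2 r.2 hqp hqr) ?_
    exact sup_le (le_inf hqp le_sup_left) (inf_le_inf_left _ le_sup_right)

theorem distributiveElements_subset_modularElements :
    distributiveElements P ⊆ modularElements P := by
  intro e he
  rw [mem_distributiveElements] at he
  rw [mem_modularElements]
  intro p q r hp hq hr hpr
  rw [inf_comm]
  refine (he r p q hr hp hq).trans (sup_le_sup inf_le_right ?_)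
  rw [inf_comm]

theorem modularElements_subset_orthomodularElements :
    modularElements P ⊆ orthomodularElements P := by
  intro e he
  rw [mem_modularElements] at he
  rw [mem_orthomodularElements]
  intro p q r hp hq hr hqp _
  rw [inf_comm, inf_comm p r]
  exact he q r p hq hr hp hqp

theorem typeCover_mono {S T : Set P} (h : S ⊆ T) : typeCover S ≤ typeCover T :=
  sSup_le_sSup (Set.image_mono h)

namespace HasContinuousCenter

variable (hP : HasContinuousCenter P)
include hP

theorem isTypeIdeal_distributiveElements : IsTypeIdeal (distributiveElements P) := by
  refine hP.isTypeIdeal_of_local ?_ ?_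
  · intro s t hst ht
    rw [mem_distributiveElements] at ht ⊢
    exact fun p q r hp hq hr => ht p q r (hp.trans hst) (hq.trans hst) (hr.trans hst)
  · intro e C hC he h
    rw [mem_distributiveElements]
    intro p q r hp hq hr
    refine hP.le_of_forall_inf_le hC (inf_le_left.trans (hp.trans he)) fun c hc => ?_
    have := mem_distributiveElements.1 (h c hc) (p ⊓ c) (q ⊓ c) (r ⊓ c) (inf_le_inf_right _ hp)
      (inf_le_inf_right _ hq) (inf_le_inf_right _ hr)
    rw [← (hC c hc).sup_inf, ← inf_inf_distrib_right] at this
    exact this.trans (sup_le_sup (inf_le_inf inf_le_left inf_le_left)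
      (inf_le_inf inf_le_left inf_le_left))

theorem isTypeIdeal_modularElements : IsTypeIdeal (modularElements P) := by
  refine hP.isTypeIdeal_of_local ?_ ?_
  · intro s t hst ht
    rw [mem_modularElements] at ht ⊢
    exact fun p q r hp hq hr => ht p q r (hp.trans hst) (hq.trans hst) (hr.trans hst)
  · intro e C hC he h
    rw [mem_modularElements]
    intro p q r hp hq hr hpr
    refine hP.le_of_forall_inf_le hC (inf_le_right.trans (hr.trans he)) fun c hc => ?_
    have := mem_modularElements.1 (h c hc) (p ⊓ c) (q ⊓ c) (r ⊓ c) (inf_le_inf_right _ hp)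
      (inf_le_inf_right _ hq) (inf_le_inf_right _ hr) (inf_le_inf_right _ hpr)
    rw [← (hC c hc).sup_inf, ← inf_inf_distrib_right] at this
    exact this.trans (sup_le_sup inf_le_left (inf_le_inf inf_le_left inf_le_left))

theorem isTypeIdeal_orthomodularElements : IsTypeIdeal (orthomodularElements P) := by
  refine hP.isTypeIdeal_of_local ?_ ?_
  · intro s t hst ht
    rw [mem_orthomodularElements] at ht ⊢
    exact fun p q r hp hq hr => ht p q r (hp.trans hst) (hq.trans hst) (hr.trans hst)
  · intro e C hC he h
    rw [mem_orthomodularElements]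
    intro p q r hp hq hr hqp hqr
    refine hP.le_of_forall_inf_le hC (inf_le_left.trans (hp.trans he)) fun c hc => ?_
    have := mem_orthomodularElements.1 (h c hc) (p ⊓ c) (q ⊓ c) (r ⊓ c) (inf_le_inf_right _ hp)
      (inf_le_inf_right _ hq) (inf_le_inf_right _ hr) (inf_le_inf_right _ hqp)
      (hqr.mono inf_le_left inf_le_left)
    rw [← (hC c hc).sup_inf, ← inf_inf_distrib_right] at this
    exact this.trans (sup_le_sup inf_le_left (inf_le_inf inf_le_left inf_le_left))

end HasContinuousCenter

/-! ### The central element attached to a type ideal -/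

theorem IsTypeIdeal.inf_mem {T : Set P} (hT : IsTypeIdeal T) {t c : P} (ht : t ∈ T)
    (hc : IsCentral c) : t ⊓ c ∈ T := by
  have hpair : ({t ⊓ c, t ⊓ cᶜ} : Set P).Pairwise VeryOrth := by
    have h : VeryOrth (t ⊓ c) (t ⊓ cᶜ) :=
      Orth.mono (show Orth c cᶜ by simp [Orth]) (centralCover_le hc inf_le_right)
        (centralCover_le hc.compl inf_le_right)
    rw [Set.pairwise_pair]
    exact fun _ => ⟨h, Orth.symm h⟩
  refine (hT _ hpair).2 ?_ (Set.mem_insert _ _)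
  rw [sSup_pair, ← hc.inf_sup_inf_compl]
  exact ht

theorem IsTypeIdeal.bot_mem {T : Set P} (hT : IsTypeIdeal T) : (⊥ : P) ∈ T := by
  simpa using (hT ∅ (Set.pairwise_empty _)).1 (Set.empty_subset _)

/-- A nonzero central element below the type cover of `T` majorizes a nonzero element of `T`. -/
theorem IsTypeIdeal.exists_mem_le {T : Set P} (hT : IsTypeIdeal T) {w : P} (hw : IsCentral w)
    (hwT : w ≤ typeCover T) (hw0 : w ≠ ⊥) : ∃ t ∈ T, t ≤ w ∧ t ≠ ⊥ := by
  by_contra! h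
  refine hw0 (le_bot_of_le_compl hwT (le_compl_comm.1 (sSup_le ?_)))
  rintro _ ⟨t, ht, rfl⟩
  refine centralCover_le hw.compl ?_
  have hbot : t ⊓ w = ⊥ := h _ (hT.inf_mem ht hw) inf_le_right
  have := hw.inf_sup_inf_compl t
  rw [hbot, bot_sup_eq] at this
  exact this ▸ inf_le_right

namespace HasContinuousCenter

variable (hP : HasContinuousCenter P)
include hP

/-- A maximal very orthogonal family in a type ideal `T` has a join in `T`, whose central cover is
as large as possible. -/
theorem exists_centralCover_eq_typeCover {T : Set P} (hT : IsTypeIdeal T) :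
    ∃ t ∈ T, centralCover t = typeCover T := by
  obtain ⟨S, hS⟩ : ∃ S, Maximal (fun S : Set P => S ⊆ T ∧ S.Pairwise VeryOrth) S := by
    refine zorn_subset _ fun c hc hchain => ⟨⋃₀ c, ⟨Set.sUnion_subset fun s hs => (hc hs).1, ?_⟩,
      fun s hs => Set.subset_sUnion_of_mem hs⟩
    exact (Set.pairwise_sUnion hchain.directedOn).2 fun s hs => (hc hs).2
  refine ⟨sSup S, (hT S hS.prop.2).1 hS.prop.1, le_antisymm ?_ ?_⟩
  · exact le_sSup ⟨_, (hT S hS.prop.2).1 hS.prop.1, rfl⟩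
  refine sSup_le ?_
  rintro _ ⟨t, ht, rfl⟩
  set z := centralCover (sSup S) with hz
  have hzc : IsCentral z := hP.isCentral_centralCover _
  -- the part of `t` outside `z` can be added to the family, so it belongs to it already
  have hmem : t ⊓ zᶜ ∈ T := hT.inf_mem ht hzc.compl
  have hcov : centralCover (t ⊓ zᶜ) ≤ zᶜ := centralCover_le hzc.compl inf_le_right
  have hins : insert (t ⊓ zᶜ) S ⊆ T ∧ (insert (t ⊓ zᶜ) S).Pairwise VeryOrth := by
    refine ⟨Set.insert_subset hmem hS.prop.1, ?_⟩
    refine hS.prop.2.insert fun s hs _ => ?_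
    have h : VeryOrth (t ⊓ zᶜ) s :=
      Orth.mono (show Orth zᶜ z from le_rfl) hcov (centralCover_mono (le_sSup hs))
    exact ⟨h, Orth.symm h⟩
  have hin : t ⊓ zᶜ ∈ S := hS.le_of_ge hins (Set.subset_insert _ _) (Set.mem_insert _ _)
  have hbot : t ⊓ zᶜ = ⊥ :=
    le_bot_of_le_compl ((le_sSup hin).trans (le_centralCover _)) inf_le_right
  refine centralCover_le hzc ?_
  have := hzc.inf_sup_inf_compl t
  rw [hbot, sup_bot_eq] at this
  exact this ▸ inf_le_right

theorem isTypeCover_iff {T : Set P} (hT : IsTypeIdeal T) (q : P) :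
    IsTypeCover T q ↔ q = typeCover T := by
  have hle : ∀ t ∈ T, t ≤ typeCover T := fun t ht =>
    (le_centralCover t).trans (le_sSup ⟨t, ht, rfl⟩)
  constructor
  · rintro ⟨hq, ⟨t, ht, rfl⟩, hT'⟩
    refine le_antisymm (le_sSup ⟨t, ht, rfl⟩) (sSup_le ?_)
    rintro _ ⟨s, hs, rfl⟩
    refine centralCover_le hq ?_
    have hbot : s ⊓ (centralCover t)ᶜ = ⊥ := by
      have : s ⊓ (centralCover t)ᶜ ∈ Set.Iic (centralCover t)ᶜ ∩ T :=
        ⟨inf_le_right, hT.inf_mem hs hq.compl⟩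
      rwa [hT'] at this
    have := hq.inf_sup_inf_compl s
    rw [hbot, sup_bot_eq] at this
    exact this ▸ inf_le_right
  · rintro rfl
    refine ⟨hP.isCentral_typeCover T, ?_, ?_⟩
    · obtain ⟨t, ht, h⟩ := hP.exists_centralCover_eq_typeCover hT
      exact ⟨t, ht, h⟩
    · ext s
      simp only [Set.mem_inter_iff, Set.mem_Iic, Set.mem_singleton_iff]
      constructor
      · exact fun h => le_bot_of_le_compl (hle s h.2) h.1
      · rintro rfl
        exact ⟨bot_le, hT.bot_mem⟩

/-! ### The four parts -/

theorem isCentral_typeI : IsCentral (typeI P) := hP.isCentral_typeCover _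

theorem isCentral_typeII : IsCentral (typeII P) :=
  hP.isCentral_inf (hP.isCentral_typeCover _).compl (hP.isCentral_typeCover _)

theorem isCentral_typeIII : IsCentral (typeIII P) :=
  hP.isCentral_inf (hP.isCentral_typeCover _).compl (hP.isCentral_typeCover _)

theorem isCentral_typeIV : IsCentral (typeIV P) := (hP.isCentral_typeCover _).compl

theorem typeI_sup_typeII_sup_typeIII_sup_typeIV :
    typeI P ⊔ typeII P ⊔ typeIII P ⊔ typeIV P = ⊤ := by
  have key : ∀ a b : P, IsCentral a → a ≤ b → a ⊔ (aᶜ ⊓ b) = b := by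
    intro a b ha hab
    conv_rhs => rw [ha.inf_sup_inf_compl b]
    rw [inf_eq_right.2 hab, inf_comm]
  unfold typeI typeII typeIII typeIV
  rw [key _ _ (hP.isCentral_typeCover _)
      (typeCover_mono distributiveElements_subset_modularElements),
    key _ _ (hP.isCentral_typeCover _)
      (typeCover_mono modularElements_subset_orthomodularElements), sup_compl_self]

end HasContinuousCenter

theorem orth_typeI_typeII : Orth (typeI P) (typeII P) :=
  le_compl_comm.1 inf_le_left

theorem orth_typeI_typeIII : Orth (typeI P) (typeIII P) :=
  le_compl_comm.1 (inf_le_left.trans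
    (compl_le_compl (typeCover_mono distributiveElements_subset_modularElements)))

theorem orth_typeI_typeIV : Orth (typeI P) (typeIV P) :=
  le_compl_comm.1 (compl_le_compl (typeCover_mono
    (distributiveElements_subset_modularElements.trans
      modularElements_subset_orthomodularElements)))

theorem orth_typeII_typeIII : Orth (typeII P) (typeIII P) :=
  inf_le_right.trans (le_compl_comm.1 inf_le_left)

theorem orth_typeII_typeIV : Orth (typeII P) (typeIV P) :=
  inf_le_right.trans (le_compl_comm.1 (compl_le_compl
    (typeCover_mono modularElements_subset_orthomodularElements)))

theorem orth_typeIII_typeIV : Orth (typeIII P) (typeIV P) :=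
  inf_le_right.trans (le_compl_comm.1 le_rfl)

end CompleteOrtholattice

namespace Annihilator

open CompleteOrtholattice

variable {A : Type*} [NonUnitalNormedRing A] [StarRing A]

/-! ### Annihilators as hereditary subalgebras -/

theorem le_def {B C : Annihilator A} : B ≤ C ↔ B.carrier ⊆ C.carrier := Iff.rfl

theorem star_mem {B : Annihilator A} {s : A} (h : s ∈ B.carrier) : star s ∈ B.carrier := by
  obtain ⟨_, T, rfl⟩ := B
  exact star_mem_perpSet h

variable [CStarRing A]

theorem mem_compl_iff {B : Annihilator A} {s : A} :
    s ∈ Bᶜ.carrier ↔ ∀ b ∈ B.carrier, b * star s = 0 ∧ b * s = 0 := Iff.rfl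

theorem mem_iff_compl {B : Annihilator A} {s : A} :
    s ∈ B.carrier ↔ ∀ t ∈ Bᶜ.carrier, t * star s = 0 ∧ t * s = 0 := by
  conv_lhs => rw [← CompleteOrtholattice.compl_compl B]
  exact mem_compl_iff

theorem mul_eq_zero {B : Annihilator A} {b s : A} (hb : b ∈ B.carrier) (hs : s ∈ Bᶜ.carrier) :
    b * s = 0 := (hs b hb).2

theorem mul_eq_zero' {B : Annihilator A} {b s : A} (hb : b ∈ B.carrier) (hs : s ∈ Bᶜ.carrier) :
    s * b = 0 := ((mem_iff_compl.1 hb) s hs).2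

theorem eq_zero_of_mul_star {a : A} (h : a * star a = 0) : a = 0 :=
  CStarRing.mul_star_self_eq_zero_iff a |>.1 h

theorem eq_zero_of_mem_compl {B : Annihilator A} {s : A} (hb : s ∈ B.carrier)
    (hs : s ∈ Bᶜ.carrier) : s = 0 :=
  eq_zero_of_mul_star (mul_eq_zero hb (star_mem hs))

/-- Annihilators are hereditary: `BAB ⊆ B`. -/
theorem mul_mul_mem {B : Annihilator A} {x y : A} (hx : x ∈ B.carrier) (hy : y ∈ B.carrier)
    (a : A) : x * a * y ∈ B.carrier := by
  rw [mem_iff_compl]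
  intro t ht
  have h1 := mul_eq_zero' hx ht
  have h2 := mul_eq_zero' (star_mem hy) ht
  constructor
  · rw [star_mul, ← mul_assoc, h2, zero_mul]
  · rw [← mul_assoc, ← mul_assoc, h1, zero_mul, zero_mul]

theorem mul_mem {B : Annihilator A} {x y : A} (hx : x ∈ B.carrier) (hy : y ∈ B.carrier) :
    x * y ∈ B.carrier := by
  rw [mem_iff_compl]
  intro t ht
  constructor
  · rw [star_mul, ← mul_assoc, mul_eq_zero' (star_mem hy) ht, zero_mul]
  · rw [← mul_assoc, mul_eq_zero' hx ht, zero_mul]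

theorem zero_mem (B : Annihilator A) : (0 : A) ∈ B.carrier := by
  rw [mem_iff_compl]
  simp

theorem add_mem {B : Annihilator A} {x y : A} (hx : x ∈ B.carrier) (hy : y ∈ B.carrier) :
    x + y ∈ B.carrier := by
  rw [mem_iff_compl] at *
  intro t ht
  simp [mul_add, hx t ht, hy t ht]

theorem isClosed_carrier (B : Annihilator A) : IsClosed B.carrier := by
  obtain ⟨_, T, rfl⟩ := B
  have : perpSet T = ⋂ t ∈ T, ({s | t * star s = 0} ∩ {s | t * s = 0}) := by
    ext s
    simp [perpSet, StarPerp]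
  change IsClosed (perpSet T)
  rw [this]
  refine isClosed_biInter fun t _ => IsClosed.inter ?_ ?_
  · exact isClosed_eq (continuous_const.mul continuous_star) continuous_const
  · exact isClosed_eq (continuous_const.mul continuous_id) continuous_const

theorem mem_inf {B C : Annihilator A} {s : A} :
    s ∈ (B ⊓ C).carrier ↔ s ∈ B.carrier ∧ s ∈ C.carrier := by
  constructor
  · exact fun h => ⟨(inf_le_left : B ⊓ C ≤ B) h, (inf_le_right : B ⊓ C ≤ C) h⟩
  · rintro ⟨hB, hC⟩
    rw [mem_iff_compl]
    intro t ht
    -- `B ⊓ C` is the infimum of `{B, C}`, hence an intersection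
    have hmem : s ∈ (sInf {B, C} : Annihilator A).carrier := by
      rintro D (rfl | rfl) <;> assumption
    rw [sInf_pair] at hmem
    exact mem_iff_compl.1 hmem t ht

theorem mem_sSup_compl {S : Set (Annihilator A)} {s : A} :
    s ∈ (sSup S)ᶜ.carrier ↔ ∀ B ∈ S, s ∈ Bᶜ.carrier := by
  rw [CompleteOrtholattice.compl_sSup]
  constructor
  · exact fun h B hB => h _ ⟨B, hB, rfl⟩
  · rintro h _ ⟨B, hB, rfl⟩
    exact h B hB

theorem carrier_bot : (⊥ : Annihilator A).carrier = {0} := by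
  refine Set.Subset.antisymm (fun s hs => ?_) (by rintro _ rfl; exact zero_mem _)
  exact eq_zero_of_mem_compl (B := ⊥) hs ((bot_le : (⊥ : Annihilator A) ≤ ⊥ᶜ) hs)

theorem eq_bot_iff {B : Annihilator A} : B = ⊥ ↔ ∀ s ∈ B.carrier, s = 0 := by
  constructor
  · rintro rfl s hs
    rwa [carrier_bot] at hs
  · intro h
    rw [_root_.eq_bot_iff, le_def, carrier_bot]
    exact h

/-- The annihilator `{s}^⊥⊥` generated by `s`. -/
def span (s : A) : Annihilator A := (ofPerp {s})ᶜ

theorem span_compl (s : A) : (span s)ᶜ = ofPerp {s} := CompleteOrtholattice.compl_compl _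

theorem mem_span_compl {s t : A} : t ∈ (span s)ᶜ.carrier ↔ s * star t = 0 ∧ s * t = 0 := by
  rw [span_compl]
  change (∀ x ∈ ({s} : Set A), StarPerp x t) ↔ _
  simp [StarPerp]

theorem mem_span {s : A} (hs : star s = s) : s ∈ (span s).carrier := by
  rw [mem_iff_compl]
  intro t ht
  rw [mem_span_compl] at ht
  have h1 := congrArg star ht.1
  rw [star_mul, star_star, hs, star_zero] at h1
  exact ⟨by rw [hs, h1], h1⟩

/-- If `x c x* ∈ C` for all `x ∈ X ∩ ⋁ C` and `c ∈ C`, then `X` distributes over `⋁ C`. For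
`s ⊥ X ∩ C`, the element `y = x* s` satisfies `C y = 0` for all `C`, so that `y y*` lies both in
`⋁ C` and in its orthocomplement. -/
theorem inf_sSup_le_of_mul_mem (X : Annihilator A) (S : Set (Annihilator A))
    (h : ∀ C ∈ S, ∀ x ∈ (X ⊓ sSup S).carrier, ∀ c ∈ C.carrier, x * c * star x ∈ C.carrier) :
    X ⊓ sSup S ≤ sSup ((X ⊓ ·) '' S) := by
  intro x hx
  suffices key : ∀ s ∈ (sSup ((X ⊓ ·) '' S))ᶜ.carrier, ∀ x ∈ (X ⊓ sSup S).carrier, s * x = 0 from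
    mem_iff_compl.2 fun s hs => ⟨key s hs _ (star_mem hx), key s hs _ hx⟩
  intro s hs x hx
  have hx2 : x ∈ (sSup S).carrier := (mem_inf.1 hx).2
  have hmem : star (s * x) * star (star (s * x)) ∈ (sSup S)ᶜ.carrier := by
    rw [mem_sSup_compl]
    intro C hC
    have hzero : ∀ d ∈ C.carrier, d * star (s * x) = 0 := by
      intro d hd
      have hdd := h C hC x hx _ (mul_mem (star_mem hd) hd)
      have hXC : x * (star d * d) * star x ∈ (X ⊓ C).carrier :=
        mem_inf.2 ⟨mul_mul_mem (mem_inf.1 hx).1 (star_mem (mem_inf.1 hx).1) _, hdd⟩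
      have hs' := mul_eq_zero' hXC (mem_sSup_compl.1 hs _ ⟨C, hC, rfl⟩)
      rw [← CStarRing.star_mul_self_eq_zero_iff]
      calc star (d * star (s * x)) * (d * star (s * x))
          = s * (x * (star d * d) * star x) * star s := by simp only [star_mul, star_star, mul_assoc]
        _ = 0 := by rw [hs', zero_mul]
    rw [mem_compl_iff]
    intro d hd
    simp only [star_mul, star_star] at hzero ⊢
    constructor <;> rw [← mul_assoc, hzero d hd, zero_mul]
  have hmem' : star (s * x) * star (star (s * x)) ∈ (sSup S).carrier := by
    have := mul_mul_mem (star_mem hx2) hx2 (star s * s)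
    simpa only [star_mul, star_star, mul_assoc] using this
  exact star_eq_zero.1 (eq_zero_of_mul_star (eq_zero_of_mem_compl hmem' hmem))

/-! ### Central annihilators are ideals -/

/-- An annihilator is an ideal if it absorbs multiplication from the left; as annihilators are
closed under the involution, it is then a two-sided ideal. -/
def IsIdeal (B : Annihilator A) : Prop := ∀ a, ∀ b ∈ B.carrier, a * b ∈ B.carrier

omit [CStarRing A] in
theorem IsIdeal.mul_mem_right {B : Annihilator A} (hB : IsIdeal B) (a : A) {b : A}
    (hb : b ∈ B.carrier) : b * a ∈ B.carrier := by
  simpa using star_mem (hB (star a) _ (star_mem hb))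

theorem IsIdeal.compl {B : Annihilator A} (hB : IsIdeal B) : IsIdeal Bᶜ := by
  intro a c hc
  rw [mem_compl_iff]
  intro b hb
  constructor
  · rw [star_mul, ← mul_assoc, (hc b hb).1, zero_mul]
  · rw [← mul_assoc, mul_eq_zero (hB.mul_mem_right a hb) hc]

theorem IsIdeal.sSup {S : Set (Annihilator A)} (hS : ∀ B ∈ S, IsIdeal B) : IsIdeal (sSup S) := by
  rw [← CompleteOrtholattice.compl_compl (SupSet.sSup S)]
  refine IsIdeal.compl fun a b hb => ?_
  rw [mem_sSup_compl] at *
  exact fun B hB => (hS B hB).compl a b (hb B hB)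

theorem inf_sSup_le_of_isIdeal {S : Set (Annihilator A)} (hS : ∀ B ∈ S, IsIdeal B)
    (X : Annihilator A) : X ⊓ sSup S ≤ sSup ((X ⊓ ·) '' S) :=
  inf_sSup_le_of_mul_mem X S fun C hC x _ _ hc =>
    (hS C hC).mul_mem_right _ (hS C hC x _ hc)

theorem IsIdeal.isCentral {B : Annihilator A} (hB : IsIdeal B) : IsCentral B := by
  refine isCentral_of_le fun X => ?_
  have := inf_sSup_le_of_isIdeal (S := {B, Bᶜ})
    (by rintro C (rfl | rfl); exacts [hB, hB.compl]) X
  simpa [Set.image_pair, sSup_pair] using this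

/-- Every element has an absolute value. This holds in all C*-algebras; as a hypothesis it allows
the results to be applied to `*`-algebras of operators without first making them C*-algebras. -/
def HasAbs (A : Type*) [NonUnitalNormedRing A] [StarRing A] : Prop :=
  ∀ x : A, ∃ k : A, star k = k ∧ k * k = star x * x

/-- If `B` and `C` are orthogonal and `BAC ≠ 0`, then some nonzero annihilator below `B ⊔ C` meets
both trivially. For a nonzero `x` with left support in `B` and right support in `C`, this is the
annihilator generated by `g g*` with `g = |x| + x`: it is annihilated by `(|x| - x)*`, whose two
terms detect the parts in `C` and in `B`. -/
theorem exists_inf_eq_bot (hA : HasAbs A) {B C : Annihilator A} (hBC : B ≤ Cᶜ) {x : A} (hx : x ≠ 0)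
    (hxB : ∀ t ∈ Bᶜ.carrier, t * x = 0) (hxC : ∀ t ∈ Cᶜ.carrier, x * t = 0) :
    ∃ D ≤ B ⊔ C, D ≠ ⊥ ∧ D ⊓ B = ⊥ ∧ D ⊓ C = ⊥ := by
  obtain ⟨k, hk, hkx⟩ := hA x
  have hkC : ∀ t ∈ Cᶜ.carrier, k * t = 0 := by
    intro t ht
    rw [← CStarRing.star_mul_self_eq_zero_iff]
    calc star (k * t) * (k * t) = star t * (k * k) * t := by
          simp only [star_mul, hk, mul_assoc]
      _ = star t * star x * (x * t) := by rw [hkx]; simp only [mul_assoc]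
      _ = 0 := by rw [hxC t ht, mul_zero]
  have hkC' : ∀ t ∈ Cᶜ.carrier, t * k = 0 := by
    intro t ht
    simpa [hk] using congrArg star (hkC _ (star_mem ht))
  have hCB : C ≤ Bᶜ := le_compl_comm.1 hBC
  have hkx0 : k * x = 0 := by
    refine hxB k (mem_compl_iff.2 fun b hb => ?_)
    rw [hk]
    exact ⟨hkC' b (hBC hb), hkC' b (hBC hb)⟩
  have hxk0 : star x * k = 0 := by simpa [hk] using congrArg star hkx0
  set g := k + x with hg
  set m := k - x with hm
  have hmg : star m * g = 0 := by
    rw [hm, hg, star_sub, hk, sub_mul, mul_add, mul_add, hkx0, hxk0, hkx]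
    abel
  have hgm : star g * m = 0 := by simpa using congrArg star hmg
  have hgg : star (g * star g) = g * star g := by simp
  have hcompl : ∀ s : A, s * g = 0 → star s * g = 0 → s ∈ (span (g * star g))ᶜ.carrier := by
    intro s h1 h2
    have h1' := congrArg star h1
    have h2' := congrArg star h2
    simp only [star_mul, star_star, star_zero] at h1' h2'
    rw [mem_span_compl, mul_assoc, mul_assoc, h1', h2', mul_zero]
    exact ⟨rfl, rfl⟩
  have hms : ∀ s ∈ (span (g * star g)).carrier, k * s = star x * s := by
    intro s hs
    have hmm : m * star m ∈ (span (g * star g))ᶜ.carrier := by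
      rw [mem_span_compl, star_mul, star_star]
      have : g * star g * (m * star m) = 0 := by
        rw [mul_assoc, ← mul_assoc (star g), hgm, zero_mul, mul_zero]
      exact ⟨this, this⟩
    have h1 := mul_eq_zero' hs hmm
    have h2 : star m * s = 0 := by
      rw [← CStarRing.star_mul_self_eq_zero_iff, star_mul, star_star, mul_assoc,
        ← mul_assoc m, h1, mul_zero]
    rw [hm, star_sub, hk, sub_mul, sub_eq_zero] at h2
    exact h2
  -- an element of the new annihilator killed from the left by `|x|` and by `x*` vanishes
  have hfin : ∀ D : Annihilator A, (∀ s ∈ (span (g * star g) ⊓ D).carrier,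
      k * s = 0 ∨ star x * s = 0) → span (g * star g) ⊓ D = ⊥ := by
    intro D hD
    have key : ∀ s ∈ (span (g * star g) ⊓ D).carrier, star s * g = 0 := by
      intro s hs
      have h1 := hms s (mem_inf.1 hs).1
      have h2 : k * s = 0 ∧ star x * s = 0 := by
        rcases hD s hs with h | h
        · exact ⟨h, h1 ▸ h⟩
        · exact ⟨h1.trans h, h⟩
      have h3 := congrArg star h2.1
      have h4 := congrArg star h2.2
      simp only [star_mul, star_star, star_zero, hk] at h3 h4
      rw [hg, mul_add, h3, h4, add_zero]
    rw [eq_bot_iff]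
    intro s hs
    refine eq_zero_of_mem_compl (mem_inf.1 hs).1 (hcompl s ?_ (key s hs))
    simpa using key _ (star_mem hs)
  refine ⟨span (g * star g), ?_, ?_, hfin B fun s hs => ?_, hfin C fun s hs => ?_⟩
  · rw [← CompleteOrtholattice.compl_compl (B ⊔ C), CompleteOrtholattice.le_compl_comm, CompleteOrtholattice.compl_sup]
    have key : ∀ s ∈ (Bᶜ ⊓ Cᶜ).carrier, s * g = 0 := fun s hs => by
      rw [hg, mul_add, hxB s (mem_inf.1 hs).1, hkC' s (mem_inf.1 hs).2, add_zero]
    exact fun s hs => hcompl s (key s hs) (key _ (star_mem hs))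
  · intro hbot
    have h1 := eq_zero_of_mul_star (eq_bot_iff.1 hbot _ (mem_span hgg))
    have h2 : k * g = k * k := by rw [hg, mul_add, hkx0, add_zero]
    rw [h1, mul_zero, hkx] at h2
    exact hx ((CStarRing.star_mul_self_eq_zero_iff x).1 h2.symm)
  · exact Or.inl (hkC s (hBC (mem_inf.1 hs).2))
  · have h1 := hxB _ (star_mem (hCB (mem_inf.1 hs).2))
    exact Or.inr (by simpa using congrArg star h1)

/-- The central annihilators are the ideals: if `B` is central, then `t a b = 0` for `b ∈ B` and
`t ∈ B^⊥`, as otherwise `exists_inf_eq_bot` provides an annihilator which `B` does not split. -/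
theorem isCentral_iff_isIdeal (hA : HasAbs A) {B : Annihilator A} : IsCentral B ↔ IsIdeal B := by
  refine ⟨fun hB a b hb => ?_, IsIdeal.isCentral⟩
  rw [mem_iff_compl]
  intro t ht
  refine ⟨by rw [star_mul, ← mul_assoc, mul_eq_zero' (star_mem hb) ht, zero_mul], ?_⟩
  by_contra hne
  obtain ⟨D, -, hD, h1, h2⟩ := exists_inf_eq_bot hA (B := B) (C := Bᶜ)
    (x := star (t * (a * b))) (by simp) (star_ne_zero.2 hne)
    (fun s hs => by
      rw [star_mul, star_mul, ← mul_assoc, ← mul_assoc, mul_eq_zero' (star_mem hb) hs,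
        zero_mul, zero_mul])
    (fun s hs => by
      rw [CompleteOrtholattice.compl_compl] at hs
      rw [star_mul, mul_assoc, mul_eq_zero' hs (star_mem ht), mul_zero])
  have := hB.inf_sup_inf_compl D
  rw [h1, h2, sup_bot_eq] at this
  exact hD this

theorem hasContinuousCenter (hA : HasAbs A) : HasContinuousCenter (Annihilator A) where
  isCentral_sSup _ hC := (IsIdeal.sSup fun c hc => (isCentral_iff_isIdeal hA).1 (hC c hc)).isCentral
  inf_sSup_le _ hC X := inf_sSup_le_of_isIdeal (fun c hc => (isCentral_iff_isIdeal hA).1 (hC c hc)) X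

end Annihilator

namespace Annihilator

open CompleteOrtholattice

/-! ### The decomposition of a C*-algebra -/

theorem hasAbs_of_nonUnitalCStarAlgebra (A : Type*) [NonUnitalCStarAlgebra A] : HasAbs A := by
  let _ : PartialOrder A := CStarAlgebra.spectralOrder A
  have : StarOrderedRing A := CStarAlgebra.spectralOrderedRing A
  exact fun x => ⟨CFC.abs x, (CFC.abs_nonneg x).isSelfAdjoint.star_eq, CFC.abs_mul_abs x⟩

section StarRing

variable {A : Type*} [NonUnitalNormedRing A] [StarRing A] [CStarRing A]

theorem starPerp_of_orth {B C : Annihilator A} (h : Orth B C) {b c : A} (hb : b ∈ B.carrier)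
    (hc : c ∈ C.carrier) : StarPerp b c :=
  h.symm hc b hb

theorem isIdeal_typePart (hA : HasAbs A) (i : Fin 4) : IsIdeal (typePart A i) := by
  have hP := hasContinuousCenter hA
  rw [← isCentral_iff_isIdeal hA]
  fin_cases i
  exacts [hP.isCentral_typeI, hP.isCentral_typeII, hP.isCentral_typeIII, hP.isCentral_typeIV]

theorem orth_typePart {i j : Fin 4} (h : i ≠ j) : Orth (typePart A i) (typePart A j) := by
  have key : ∀ i j : Fin 4, i < j → Orth (typePart A i) (typePart A j) := by
    intro i j
    fin_cases i <;> fin_cases j <;> intro hij <;> first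
      | exact absurd hij (by decide)
      | exact orth_typeI_typeII
      | exact orth_typeI_typeIII
      | exact orth_typeI_typeIV
      | exact orth_typeII_typeIII
      | exact orth_typeII_typeIV
      | exact orth_typeIII_typeIV
  rcases lt_or_gt_of_ne h with h | h
  · exact key i j h
  · exact (key j i h).symm

/-- The four parts have no common annihilator. -/
theorem eq_zero_of_forall_mem_typePart_compl (hA : HasAbs A) {s : A}
    (hs : ∀ i, s ∈ (typePart A i)ᶜ.carrier) : s = 0 := by
  have h := congrArg (·ᶜ) (hasContinuousCenter hA).typeI_sup_typeII_sup_typeIII_sup_typeIV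
  simp only [CompleteOrtholattice.compl_sup, CompleteOrtholattice.compl_top] at h
  exact eq_bot_iff.1 h s (mem_inf.2 ⟨mem_inf.2 ⟨mem_inf.2 ⟨hs 0, hs 1⟩, hs 2⟩, hs 3⟩)

theorem star_mul_sum_eq {ι : Type*} [Fintype ι] {B : ι → Annihilator A}
    (hB : ∀ i j, i ≠ j → Orth (B i) (B j)) {f : ι → A} (hf : ∀ i, f i ∈ (B i).carrier) (i : ι) :
    star (f i) * ∑ j, f j = star (f i) * f i := by
  rw [Finset.mul_sum]
  refine Finset.sum_eq_single i (fun j _ hji => ?_) (by simp)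
  exact (starPerp_of_orth (hB i j hji.symm) (star_mem (hf i)) (hf j)).2

/-- Each component of a sum of mutually orthogonal elements is dominated by the sum. -/
theorem norm_le_norm_sum {ι : Type*} [Fintype ι] {B : ι → Annihilator A}
    (hB : ∀ i j, i ≠ j → Orth (B i) (B j)) {f : ι → A} (hf : ∀ i, f i ∈ (B i).carrier) (i : ι) :
    ‖f i‖ ≤ ‖∑ j, f j‖ := by
  rcases eq_or_ne (f i) 0 with h | h
  · simp [h]
  refine le_of_mul_le_mul_left ?_ (norm_pos_iff.2 h)
  rw [← CStarRing.norm_star_mul_self, ← star_mul_sum_eq hB hf i]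
  exact (norm_mul_le _ _).trans (by rw [norm_star])

theorem isDirect_of_orth {ι : Type*} [Fintype ι] {B : ι → Annihilator A}
    (hB : ∀ i j, i ≠ j → Orth (B i) (B j)) : IsDirect fun i => (B i).carrier := by
  intro f g hf hg h
  funext i
  have hneg : ∀ i, f i - g i ∈ (B i).carrier := by
    intro i
    rw [mem_iff_compl]
    intro t ht
    have h1 := mem_iff_compl.1 (hf i) t ht
    have h2 := mem_iff_compl.1 (hg i) t ht
    simp [mul_sub, h1, h2]
  have := norm_le_norm_sum hB hneg i
  rwa [Finset.sum_sub_distrib, h, sub_self, norm_zero, norm_le_zero_iff, sub_eq_zero] at this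

theorem isClosed_sumSet [CompleteSpace A] {ι : Type*} [Fintype ι] {B : ι → Annihilator A}
    (hB : ∀ i j, i ≠ j → Orth (B i) (B j)) : IsClosed (sumSet fun i => (B i).carrier) := by
  have hneg : ∀ i, ∀ x ∈ (B i).carrier, ∀ y ∈ (B i).carrier, x - y ∈ (B i).carrier := by
    intro i x hx y hy
    rw [mem_iff_compl] at *
    intro t ht
    simp [mul_sub, hx t ht, hy t ht]
  rw [← isSeqClosed_iff_isClosed]
  intro u a hu hua
  choose f hf hfu using hu
  have hcauchy : ∀ i, CauchySeq fun n => f n i := by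
    intro i
    have h := Metric.cauchySeq_iff.1 hua.cauchySeq
    refine Metric.cauchySeq_iff.2 fun ε hε => ?_
    obtain ⟨N, hN⟩ := h ε hε
    refine ⟨N, fun m hm n hn => lt_of_le_of_lt ?_ (hN m hm n hn)⟩
    have := norm_le_norm_sum hB (f := fun j => f m j - f n j)
      (fun j => hneg j _ (hf m j) _ (hf n j)) i
    rwa [Finset.sum_sub_distrib, hfu, hfu, ← dist_eq_norm, ← dist_eq_norm] at this
  choose g hg using fun i => cauchySeq_tendsto_of_complete (hcauchy i)
  refine ⟨g, fun i => (isClosed_carrier (B i)).mem_of_tendsto (hg i)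
    (Filter.Eventually.of_forall fun n => hf n i), ?_⟩
  refine tendsto_nhds_unique ?_ hua
  rw [show u = fun n => ∑ i, f n i from funext fun n => (hfu n).symm]
  exact tendsto_finsetSum _ fun i _ => hg i

end StarRing

variable {A : Type*} [NonUnitalCStarAlgebra A]

theorem smul_mem {B : Annihilator A} (c : ℂ) {x : A} (hx : x ∈ B.carrier) :
    c • x ∈ B.carrier := by
  rw [mem_iff_compl] at *
  intro t ht
  simp [hx t ht, mul_smul_comm]

theorem IsIdeal.isClosedIdeal {B : Annihilator A} (hB : IsIdeal B) : IsClosedIdeal B.carrier where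
  zero_mem := zero_mem B
  add_mem _ ha _ hb := add_mem ha hb
  smul_mem c _ ha := smul_mem c ha
  mul_mem_left x a ha := hB x a ha
  mul_mem_right x _ ha := hB.mul_mem_right x ha
  isClosed := isClosed_carrier B

theorem isClosedIdeal_sumSet {ι : Type*} [Fintype ι] {B : ι → Annihilator A}
    (hB : ∀ i j, i ≠ j → Orth (B i) (B j)) (hI : ∀ i, IsIdeal (B i)) :
    IsClosedIdeal (sumSet fun i => (B i).carrier) where
  zero_mem := ⟨0, fun i => zero_mem _, by simp⟩
  add_mem := by
    rintro _ ⟨f, hf, rfl⟩ _ ⟨g, hg, rfl⟩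
    exact ⟨fun i => f i + g i, fun i => add_mem (hf i) (hg i), Finset.sum_add_distrib⟩
  smul_mem := by
    rintro c _ ⟨f, hf, rfl⟩
    exact ⟨fun i => c • f i, fun i => smul_mem c (hf i), Finset.smul_sum.symm⟩
  mul_mem_left := by
    rintro x _ ⟨f, hf, rfl⟩
    exact ⟨fun i => x * f i, fun i => hI i x _ (hf i), Finset.mul_sum _ _ _ |>.symm⟩
  mul_mem_right := by
    rintro x _ ⟨f, hf, rfl⟩
    exact ⟨fun i => f i * x, fun i => (hI i).mul_mem_right x (hf i), Finset.sum_mul _ _ _ |>.symm⟩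
  isClosed := isClosed_sumSet hB

theorem isEssential_sumSet_typePart : IsEssential (sumSet fun i => (typePart A i).carrier) := by
  have hzero : ∀ s ∈ perpSet (sumSet fun i => (typePart A i).carrier), s = 0 := by
    refine fun s hs => eq_zero_of_forall_mem_typePart_compl (hasAbs_of_nonUnitalCStarAlgebra A)
      fun i b hb => hs b ⟨Pi.single i b, fun j => ?_, by simp⟩
    rcases eq_or_ne j i with rfl | h
    · simpa using hb
    · simpa [h] using zero_mem _
  refine Set.eq_univ_of_forall fun a s hs => ?_
  rw [hzero s hs]
  simp [StarPerp]

/-- The sets `D`, `M`, `O` are type ideals. -/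
theorem isTypeIdeal_of_mem {A : Type*} [NonUnitalNormedRing A] [StarRing A] [CStarRing A]
    (hA : HasAbs A) {T : Set (Annihilator A)}
    (hT : T ∈ ({distributiveElements (Annihilator A), modularElements (Annihilator A),
      orthomodularElements (Annihilator A)} : Set (Set (Annihilator A)))) : IsTypeIdeal T := by
  have hP := hasContinuousCenter hA
  rcases hT with rfl | rfl | rfl
  exacts [hP.isTypeIdeal_distributiveElements, hP.isTypeIdeal_modularElements,
    hP.isTypeIdeal_orthomodularElements]

end Annihilator

namespace Annihilator

open CompleteOrtholattice

variable {R : Type*} [NormedRing R] [StarRing R] [CStarRing R]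

/-! ### Corners of Baer `*`-rings -/

/-- The annihilator `eRe` of a projection `e`. -/
def corner (e : R) : Annihilator R := ofPerp {1 - e}

omit [CStarRing R] in
theorem mem_corner {e s : R} (he : IsStarProjection e) :
    s ∈ (corner e).carrier ↔ e * s = s ∧ s * e = s := by
  change (∀ t ∈ ({1 - e} : Set R), StarPerp t s) ↔ _
  simp only [Set.mem_singleton_iff, forall_eq, StarPerp, sub_mul, one_mul, sub_eq_zero]
  constructor
  · rintro ⟨h1, h2⟩
    have := congrArg star h1
    rw [star_mul, star_star, he.isSelfAdjoint.star_eq] at this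
    exact ⟨h2.symm, this.symm⟩
  · rintro ⟨h1, h2⟩
    have := congrArg star h2
    rw [star_mul, he.isSelfAdjoint.star_eq] at this
    exact ⟨this.symm, h1.symm⟩

omit [CStarRing R] in
theorem self_mem_corner {e : R} (he : IsStarProjection e) : e ∈ (corner e).carrier :=
  (mem_corner he).2 ⟨he.isIdempotentElem.eq, he.isIdempotentElem.eq⟩

omit [CStarRing R] in
theorem below_comm {e f : R} (he : IsStarProjection e) (hf : IsStarProjection f) :
    Projections.Below e f ↔ f * e = e := by
  constructor <;> intro h
  · have := congrArg star h
    rw [star_mul, he.isSelfAdjoint.star_eq, hf.isSelfAdjoint.star_eq] at this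
    exact this.symm
  · have := congrArg star h
    rw [star_mul, he.isSelfAdjoint.star_eq, hf.isSelfAdjoint.star_eq] at this
    exact this.symm

omit [CStarRing R] in
theorem corner_le_corner {e f : R} (he : IsStarProjection e) (hf : IsStarProjection f) :
    corner e ≤ corner f ↔ Projections.Below e f := by
  rw [le_def]
  constructor
  · exact fun h => ((mem_corner hf).1 (h (self_mem_corner he))).2.symm
  · intro h s hs
    have h' := (below_comm he hf).1 h
    rw [mem_corner he] at hs
    rw [mem_corner hf]
    constructor
    · rw [← hs.1, ← mul_assoc, h']
    · rw [← hs.2, mul_assoc, ← h]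

theorem corner_compl {e : R} (he : IsStarProjection e) : (corner e)ᶜ = corner (1 - e) := by
  refine carrier_injective (Set.ext fun s => ?_)
  have hz : ∀ t : R, (1 - e) * t = t ↔ e * t = 0 := fun t => by
    rw [sub_mul, one_mul, sub_eq_self]
  rw [mem_corner he.one_sub, mem_compl_iff, hz]
  have hz' : s * (1 - e) = s ↔ e * star s = 0 := by
    rw [mul_sub, mul_one, sub_eq_self, ← star_eq_zero, star_mul, he.isSelfAdjoint.star_eq]
  rw [hz']
  constructor
  · exact fun h => ⟨(h e (self_mem_corner he)).2, (h e (self_mem_corner he)).1⟩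
  · rintro ⟨h1, h2⟩ b hb
    rw [← ((mem_corner he).1 hb).2, mul_assoc, mul_assoc, h1, h2]
    simp

theorem mem_corner_compl {e s : R} (he : IsStarProjection e) :
    s ∈ (corner e)ᶜ.carrier ↔ e * s = 0 ∧ s * e = 0 := by
  rw [corner_compl he, mem_corner he.one_sub, sub_mul, one_mul, mul_sub, mul_one,
    sub_eq_self, sub_eq_self]

theorem corner_eq_bot {e : R} (he : IsStarProjection e) : corner e = ⊥ ↔ e = 0 := by
  rw [eq_bot_iff]
  constructor
  · exact fun h => h e (self_mem_corner he)
  · rintro rfl s hs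
    rw [← ((mem_corner he).1 hs).1, zero_mul]

/-- A Baer `*`-ring: the right annihilator of each set is generated by a projection. -/
def IsBaer (R : Type*) [Ring R] [StarRing R] : Prop :=
  ∀ T : Set R, ∃ p : R, IsStarProjection p ∧ ∀ s : R, (∀ t ∈ T, t * s = 0) ↔ p * s = s

omit [CStarRing R] in
theorem IsBaer.exists_eq_corner (hR : IsBaer R) (B : Annihilator R) :
    ∃ p : R, IsStarProjection p ∧ B = corner p := by
  obtain ⟨_, T, rfl⟩ := B
  obtain ⟨p, hp, h⟩ := hR T
  refine ⟨p, hp, carrier_injective (Set.ext fun s => ?_)⟩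
  rw [mem_corner hp, ← h]
  have h2 : s * p = s ↔ p * star s = star s := by
    rw [← star_inj, star_mul, hp.isSelfAdjoint.star_eq]
  rw [h2, ← h]
  change (∀ t ∈ T, StarPerp t s) ↔ _
  exact ⟨fun hs => ⟨fun t ht => (hs t ht).2, fun t ht => (hs t ht).1⟩,
    fun hs t ht => ⟨hs.2 t ht, hs.1 t ht⟩⟩

theorem mul_eq_zero_of_mul_mul_star {a b : R} (h : a * (b * star b) = 0) : a * b = 0 := by
  refine eq_zero_of_mul_star ?_
  rw [star_mul, mul_assoc, ← mul_assoc b, ← mul_assoc a, h, zero_mul]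

omit [CStarRing R] in
theorem IsIdeal.isCentralProjection {z : R} (hz : IsStarProjection z) (h : IsIdeal (corner z)) :
    Projections.IsCentralProjection z := by
  refine ⟨hz, fun a => ?_⟩
  have h1 := ((mem_corner hz).1 (h a z (self_mem_corner hz))).1
  have h2 := ((mem_corner hz).1 (h.mul_mem_right a (self_mem_corner hz))).2
  rw [← h2, mul_assoc, h1]

omit [CStarRing R] in
theorem isIdeal_corner {z : R} (hz : Projections.IsCentralProjection z) :
    IsIdeal (corner z) := by
  intro a b hb
  rw [mem_corner hz.1] at *
  constructor
  · rw [← mul_assoc, hz.2, mul_assoc, hb.1]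
  · rw [mul_assoc, hb.2]

/-! ### Orthomodularity -/

theorem IsBaer.top_mem_orthomodularElements (hR : IsBaer R) :
    (⊤ : Annihilator R) ∈ orthomodularElements (Annihilator R) := by
  rw [mem_orthomodularElements]
  rintro P Q S - - - hQP hQS
  obtain ⟨p, hp, rfl⟩ := hR.exists_eq_corner P
  obtain ⟨q, hq, rfl⟩ := hR.exists_eq_corner Q
  obtain ⟨r, hr, rfl⟩ := hR.exists_eq_corner S
  rw [corner_le_corner hq hp, below_comm hq hp] at hQP
  have hqr : q * r = 0 := (starPerp_of_orth hQS (self_mem_corner hq) (self_mem_corner hr)).2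
  have hrq : r * q = 0 := by
    simpa [hq.isSelfAdjoint.star_eq, hr.isSelfAdjoint.star_eq] using congrArg star hqr
  have hqr' : IsStarProjection (q + r) := by
    refine ⟨?_, hq.isSelfAdjoint.add hr.isSelfAdjoint⟩
    rw [IsIdempotentElem, add_mul, mul_add, mul_add, hqr, hrq, hq.isIdempotentElem.eq,
      hr.isIdempotentElem.eq, add_zero, zero_add]
  have hsup : corner q ⊔ corner r ≤ corner (q + r) := by
    refine sup_le ((corner_le_corner hq hqr').2 ?_) ((corner_le_corner hr hqr').2 ?_)
    · rw [Projections.Below, mul_add, hqr, add_zero, hq.isIdempotentElem.eq]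
    · rw [Projections.Below, mul_add, hrq, zero_add, hr.isIdempotentElem.eq]
  have key : ∀ t ∈ (corner q ⊔ corner p ⊓ corner r)ᶜ.carrier,
      ∀ s ∈ (corner p ⊓ (corner q ⊔ corner r)).carrier, t * s = 0 := by
    intro t ht s hs
    rw [CompleteOrtholattice.compl_sup, mem_inf] at ht
    have hsp := ((mem_corner hp).1 (mem_inf.1 hs).1).1
    have hsqr := ((mem_corner hqr').1 (hsup (mem_inf.1 hs).2)).1
    -- `s = q s + r s`, and `r s = s - q s` is supported in both `p` and `r`
    have hps : p * (r * s) = r * s := by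
      have : r * s = s - q * s := by rw [eq_sub_iff_add_eq, add_comm, ← add_mul, hsqr]
      rw [this, mul_sub, hsp, ← mul_assoc, hQP]
    have hmem : r * s * star (r * s) ∈ (corner p ⊓ corner r).carrier := by
      rw [mem_inf, mem_corner hp, mem_corner hr]
      have h1 : p * (r * s * star (r * s)) = r * s * star (r * s) := by rw [← mul_assoc, hps]
      have h2 : r * (r * s * star (r * s)) = r * s * star (r * s) := by
        rw [← mul_assoc, ← mul_assoc, hr.isIdempotentElem.eq]
      have h1' := congrArg star h1
      have h2' := congrArg star h2
      rw [star_mul, star_mul (r * s), star_star, hp.isSelfAdjoint.star_eq] at h1'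
      rw [star_mul, star_mul (r * s), star_star, hr.isSelfAdjoint.star_eq] at h2'
      exact ⟨⟨h1, h1'⟩, ⟨h2, h2'⟩⟩
    have h3 := mul_eq_zero_of_mul_mul_star (mul_eq_zero' hmem ht.2)
    rw [← hsqr, add_mul, mul_add, h3, ← mul_assoc, ((mem_corner_compl hq).1 ht.1).2,
      zero_mul, add_zero]
  exact fun s hs => mem_iff_compl.2 fun t ht => ⟨key t ht _ (star_mem hs), key t ht s hs⟩

/-! ### Abelian projections -/

theorem corner_mem_distributiveElements {e : R} (he : IsStarProjection e)
    (hab : Projections.IsAbelian e) : corner e ∈ distributiveElements (Annihilator R) := by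
  have hcomm : ∀ x ∈ (corner e).carrier, ∀ y ∈ (corner e).carrier, x * y = y * x := by
    intro x hx y hy
    rw [mem_corner he] at hx hy
    have := hab x y
    rwa [hx.1, hx.2, hy.1, hy.2] at this
  rw [mem_distributiveElements]
  intro X Y Z hX hY hZ
  have := inf_sSup_le_of_mul_mem X {Y, Z} fun C hC x hx c hc => ?_
  · simpa [Set.image_pair, sSup_pair] using this
  have hCe : C ≤ corner e := by rcases hC with rfl | rfl <;> assumption
  have hxe := hX (mem_inf.1 hx).1
  have key : ∀ c ∈ C.carrier, ∀ t ∈ Cᶜ.carrier, t * (x * c * star x) = 0 := by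
    intro c hc t ht
    rw [hcomm x hxe c (hCe hc), ← mul_assoc, ← mul_assoc, mul_eq_zero' hc ht, zero_mul, zero_mul]
  rw [mem_iff_compl]
  refine fun t ht => ⟨?_, key c hc t ht⟩
  simpa [mul_assoc] using key _ (star_mem hc) t ht

/-- If the annihilators below `corner p` form a distributive lattice, then every projection which
commutes with `p` commutes with the corner of `p`: otherwise its two halves of `p` would be
linked by a nonzero element, giving an annihilator that meets both trivially. -/
theorem commute_of_corner_mem_distributiveElements (hA : HasAbs R) {p : R}
    (hp : IsStarProjection p) (hD : corner p ∈ distributiveElements (Annihilator R)) {e b : R}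
    (he : IsStarProjection e) (hep : e * p = p * e) (hb : b ∈ (corner p).carrier) :
    e * b = b * e := by
  have hq : IsStarProjection (p * e) := by
    refine ⟨?_, ?_⟩
    · rw [IsIdempotentElem, mul_assoc, ← mul_assoc e, hep, mul_assoc, he.isIdempotentElem.eq,
        ← mul_assoc, hp.isIdempotentElem.eq]
    · rw [IsSelfAdjoint, star_mul, hp.isSelfAdjoint.star_eq, he.isSelfAdjoint.star_eq, hep]
  set q := p * e with hqdef
  have hpq : p * q = q := by rw [hqdef, ← mul_assoc, hp.isIdempotentElem.eq]
  have hqp : q * p = q := by rw [hqdef, mul_assoc, hep, ← mul_assoc, hp.isIdempotentElem.eq]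
  have hr : IsStarProjection (p - q) := by
    refine ⟨?_, hp.isSelfAdjoint.sub hq.isSelfAdjoint⟩
    rw [IsIdempotentElem, sub_mul, mul_sub, mul_sub, hpq, hqp, hp.isIdempotentElem.eq,
      hq.isIdempotentElem.eq, sub_self, sub_zero]
  have hqr : q * (p - q) = 0 := by rw [mul_sub, hqp, hq.isIdempotentElem.eq, sub_self]
  have hrq : (p - q) * q = 0 := by rw [sub_mul, hpq, hq.isIdempotentElem.eq, sub_self]
  have hle1 : corner q ≤ corner p := (corner_le_corner hq hp).2 hqp.symm
  have hle2 : corner (p - q) ≤ corner p := (corner_le_corner hr hp).2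
    (by rw [Projections.Below, sub_mul, hqp, hp.isIdempotentElem.eq])
  have key : ∀ b : R, q * b * (p - q) = 0 := by
    intro b
    by_contra hne
    obtain ⟨D, hD1, hD2, hD3, hD4⟩ := exists_inf_eq_bot hA (B := corner q) (C := corner (p - q))
      (by
        rw [corner_compl hr, corner_le_corner hq hr.one_sub, Projections.Below, mul_sub, hqr,
          mul_one, sub_zero]) hne
      (fun t ht => by
        rw [← mul_assoc, ← mul_assoc, ((mem_corner_compl hq).1 ht).2, zero_mul, zero_mul])
      (fun t ht => by rw [mul_assoc, ((mem_corner_compl hr).1 ht).1, mul_zero])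
    have := mem_distributiveElements.1 hD D (corner q) (corner (p - q))
      (hD1.trans (sup_le hle1 hle2)) hle1 hle2
    rw [inf_eq_left.2 hD1, hD3, hD4, sup_bot_eq, le_bot_iff] at this
    exact hD2 this
  have h1 := key b
  have h2 := congrArg star (key (star b))
  rw [star_mul, star_mul, star_star, star_zero, hq.isSelfAdjoint.star_eq,
    hr.isSelfAdjoint.star_eq] at h2
  rw [mem_corner hp] at hb
  rw [mul_sub, mul_assoc, hb.2, sub_eq_zero] at h1
  rw [← mul_assoc, mul_assoc, sub_mul, ← mul_assoc, hb.1, sub_eq_zero] at h2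
  calc e * b = e * p * b := by rw [mul_assoc, hb.1]
    _ = q * b := by rw [hep]
    _ = b * q := by rw [h1, h2, mul_assoc]
    _ = b * e := by rw [hqdef, ← mul_assoc, hb.2]

end Annihilator

namespace Annihilator

open CompleteOrtholattice

variable {R : Type*} [NormedRing R] [StarRing R] [CStarRing R]

/-! ### Finite projections are modular -/

/-- The partial isometries of polar decompositions: every `x` has a partial isometry with the same
left and right annihilators as `x`. -/
def HasPolar (R : Type*) [Ring R] [StarRing R] : Prop :=
  ∀ x : R, ∃ v : R, IsStarProjection (star v * v) ∧ (∀ s, v * s = 0 ↔ x * s = 0) ∧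
    ∀ s, star v * s = 0 ↔ star x * s = 0

theorem isStarProjection_mul_star {v : R} (hv : IsStarProjection (star v * v)) :
    IsStarProjection (v * star v) ∧ v * star v * v = v := by
  have h : v * star v * v = v := by
    rw [← sub_eq_zero, ← CStarRing.star_mul_self_eq_zero_iff]
    have h1 := hv.isIdempotentElem.eq
    simp only [star_sub, star_mul, star_star, mul_assoc, sub_mul, mul_sub] at h1 ⊢
    simp [h1]
  refine ⟨⟨?_, by simp [IsSelfAdjoint]⟩, h⟩
  rw [IsIdempotentElem, ← mul_assoc, h]

omit [CStarRing R] in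
theorem eq_of_forall_mul_eq_zero_iff {e f : R} (he : IsStarProjection e) (hf : IsStarProjection f)
    (h : ∀ s, e * s = 0 ↔ f * s = 0) : e = f := by
  have h1 : e * f = e := by
    have := (h (1 - f)).2 (by rw [mul_sub, mul_one, hf.isIdempotentElem.eq, sub_self])
    rw [mul_sub, mul_one, sub_eq_zero] at this
    exact this.symm
  have h2 : f * e = f := by
    have := (h (1 - e)).1 (by rw [mul_sub, mul_one, he.isIdempotentElem.eq, sub_self])
    rw [mul_sub, mul_one, sub_eq_zero] at this
    exact this.symm
  have h3 := congrArg star h1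
  rw [star_mul, he.isSelfAdjoint.star_eq, hf.isSelfAdjoint.star_eq, h2] at h3
  exact h3.symm

omit [CStarRing R] in
theorem isStarProjection_sub {e f : R} (he : IsStarProjection e) (hf : IsStarProjection f)
    (h : f * e = e) : IsStarProjection (f - e) ∧ e * f = e := by
  have h' : e * f = e := ((below_comm he hf).2 h).symm
  refine ⟨⟨?_, hf.isSelfAdjoint.sub he.isSelfAdjoint⟩, h'⟩
  rw [IsIdempotentElem, sub_mul, mul_sub, mul_sub, h, h', he.isIdempotentElem.eq,
    hf.isIdempotentElem.eq, sub_self, sub_zero]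

/-- The right support of `(1 - y) x` is `x - x ⊓ y`. -/
theorem one_sub_mul_mul_eq_zero_iff {x y t : R} (hx : IsStarProjection x) (hy : IsStarProjection y)
    (ht : IsStarProjection t) (h : corner t = corner x ⊓ corner y) (s : R) :
    (1 - y) * x * s = 0 ↔ (x - t) * s = 0 := by
  have htx : x * t = t :=
    (below_comm ht hx).1 ((corner_le_corner ht hx).1 (h.le.trans inf_le_left))
  have hty : y * t = t :=
    (below_comm ht hy).1 ((corner_le_corner ht hy).1 (h.le.trans inf_le_right))
  have htx' := (isStarProjection_sub ht hx htx).2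
  rw [sub_mul, one_mul, sub_mul, sub_eq_zero, sub_mul, sub_eq_zero]
  constructor
  · intro h1
    have h2 : x * (x * s) = x * s := by rw [← mul_assoc, hx.isIdempotentElem.eq]
    have h3 : y * (x * s) = x * s := by rw [← mul_assoc, ← h1]
    have hmem : x * s * star (x * s) ∈ (corner t).carrier := by
      rw [h, mem_inf, mem_corner hx, mem_corner hy]
      have h4 : x * (x * s * star (x * s)) = x * s * star (x * s) := by rw [← mul_assoc, h2]
      have h5 : y * (x * s * star (x * s)) = x * s * star (x * s) := by rw [← mul_assoc, h3]
      have h4' := congrArg star h4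
      have h5' := congrArg star h5
      rw [star_mul, star_mul (x * s), star_star, hx.isSelfAdjoint.star_eq] at h4'
      rw [star_mul, star_mul (x * s), star_star, hy.isSelfAdjoint.star_eq] at h5'
      exact ⟨⟨h4, h4'⟩, ⟨h5, h5'⟩⟩
    have h6 : (1 - t) * (x * s * star (x * s)) = 0 := by
      rw [sub_mul, one_mul, ((mem_corner ht).1 hmem).1, sub_self]
    have h7 := mul_eq_zero_of_mul_mul_star h6
    rw [sub_mul, one_mul, sub_eq_zero, ← mul_assoc, htx'] at h7
    exact h7
  · intro h1
    rw [mul_assoc, h1, ← mul_assoc, hty]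

/-- The parallelogram law: `x - x ⊓ y` is equivalent to `x ⊔ y - y`. -/
theorem exists_star_mul_self_eq_sub_inf (hpol : HasPolar R) {x y t u : R} (hx : IsStarProjection x)
    (hy : IsStarProjection y) (ht : IsStarProjection t) (hu : IsStarProjection u)
    (h : corner t = corner x ⊓ corner y) (h' : corner u = corner x ⊔ corner y) :
    ∃ v : R, star v * v = x - t ∧ v * star v = u - y := by
  obtain ⟨v, hv, hv1, hv2⟩ := hpol ((1 - y) * x)
  have hxt : IsStarProjection (x - t) := (isStarProjection_sub ht hx ((below_comm ht hx).1
    ((corner_le_corner ht hx).1 (h.le.trans inf_le_left)))).1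
  have huy : IsStarProjection (u - y) := (isStarProjection_sub hy hu ((below_comm hy hu).1
    ((corner_le_corner hy hu).1 (le_sup_right.trans h'.ge)))).1
  refine ⟨v, eq_of_forall_mul_eq_zero_iff hv hxt fun s => ?_,
    eq_of_forall_mul_eq_zero_iff (isStarProjection_mul_star hv).1 huy fun s => ?_⟩
  · rw [← one_sub_mul_mul_eq_zero_iff hx hy ht h, ← hv1]
    constructor
    · intro h0
      rw [← (isStarProjection_mul_star hv).2, mul_assoc, mul_assoc, ← mul_assoc (star v), h0,
        mul_zero]
    · intro h0
      rw [mul_assoc, h0, mul_zero]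
  · have h1 : v * star v * s = 0 ↔ star v * s = 0 := by
      constructor
      · intro h0
        have h2 := congrArg star (isStarProjection_mul_star hv).2
        rw [star_mul, star_mul, star_star] at h2
        rw [← h2, mul_assoc, h0, mul_zero]
      · intro h0
        rw [mul_assoc, h0, mul_zero]
    have h2 := one_sub_mul_mul_eq_zero_iff (x := 1 - y) (y := 1 - x) (t := 1 - u) hy.one_sub
      hx.one_sub hu.one_sub (by
        rw [← corner_compl hu, ← corner_compl hx, ← corner_compl hy, h',
          CompleteOrtholattice.compl_sup, inf_comm]) s
    rw [h1, hv2, star_mul, hx.isSelfAdjoint.star_eq, hy.one_sub.isSelfAdjoint.star_eq]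
    rwa [sub_sub_cancel, sub_sub_sub_cancel_left] at h2

/-- By the parallelogram law, comparable projections with a common relative complement are
equivalent; below a finite projection they are thus equal. -/
theorem corner_mem_modularElements (hR : IsBaer R) (hpol : HasPolar R) {e : R}
    (he : IsStarProjection e) (hfin : Projections.IsFinite e) :
    corner e ∈ modularElements (Annihilator R) := by
  -- there is no pentagon below `corner e`
  have key : ∀ X Y Z : Annihilator R, Z ≤ corner e → X ≤ Z → X ⊓ Y = Z ⊓ Y →
      X ⊔ Y = Z ⊔ Y → X = Z := by
    intro X Y Z hZe hXZ hinf hsup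
    obtain ⟨t, ht, ht'⟩ := hR.exists_eq_corner (X ⊓ Y)
    obtain ⟨u, hu, hu'⟩ := hR.exists_eq_corner (X ⊔ Y)
    obtain ⟨x, hx, rfl⟩ := hR.exists_eq_corner X
    obtain ⟨y, hy, rfl⟩ := hR.exists_eq_corner Y
    obtain ⟨z, hz, rfl⟩ := hR.exists_eq_corner Z
    obtain ⟨v, hv1, hv2⟩ := exists_star_mul_self_eq_sub_inf hpol hx hy ht hu ht'.symm hu'.symm
    obtain ⟨w, hw1, hw2⟩ := exists_star_mul_self_eq_sub_inf hpol hz hy ht hu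
      (hinf ▸ ht'.symm) (hsup ▸ hu'.symm)
    have hze := (below_comm hz he).1 ((corner_le_corner hz he).1 hZe)
    have hxz := (below_comm hx hz).1 ((corner_le_corner hx hz).1 hXZ)
    have htx := (below_comm ht hx).1 ((corner_le_corner ht hx).1 (ht'.ge.trans inf_le_left))
    have hze' := (isStarProjection_sub hz he hze).2
    have hxz' := (isStarProjection_sub hx hz hxz).2
    have htx' := (isStarProjection_sub ht hx htx).2
    have htz : z * t = t := by rw [← htx, ← mul_assoc, hxz]
    have htz' := (isStarProjection_sub ht hz htz).2
    have hte : t * e = t := by rw [← htz', mul_assoc, hze']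
    have hxe : x * e = x := by rw [← hxz', mul_assoc, hze']
    have hPx := (isStarProjection_sub ht hx htx).1
    have hPz := (isStarProjection_sub ht hz htz).1
    have hPe := (isStarProjection_sub hz he hze).1
    have hv3 := (isStarProjection_mul_star (v := v) (hv1 ▸ hPx)).2
    have hw3 := (isStarProjection_mul_star (v := w) (hw1 ▸ hPz)).2
    rw [hv2] at hv3
    rw [hw2] at hw3
    -- the equivalence of `z - t` with `x - t`, extended by the identity of `t + e - z`
    obtain ⟨a, ha1, ha2⟩ : ∃ a : R, star a * a = z - t ∧ a * star a = x - t := by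
      refine ⟨star v * w, ?_, ?_⟩
      · have : star (star v * w) * (star v * w) = star w * (v * star v * w) := by
          simp only [star_mul, star_star, mul_assoc]
        rw [this, hv2, hw3, hw1]
      · have : star v * w * star (star v * w) = star v * (w * star w * v) := by
          simp only [star_mul, star_star, mul_assoc]
        rw [this, hw2, hv3, hv1]
    have ha3 := (isStarProjection_mul_star (v := a) (ha1 ▸ hPz)).2
    set d := t + (e - z) with hd
    have hd1 : star d = d := by
      rw [hd, star_add, ht.isSelfAdjoint.star_eq, hPe.isSelfAdjoint.star_eq]
    have htt := ht.isIdempotentElem.eq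
    have hzz := hz.isIdempotentElem.eq
    have hdd : d * d = d := by
      have hez := hze
      have het : e * t = t := by rw [← htz, ← mul_assoc, hze]
      rw [hd]
      simp only [add_mul, mul_add, sub_mul, mul_sub, htt, hzz, hez, het, hze', hte, htz, htz',
        he.isIdempotentElem.eq]
      abel
    have had : a * d = 0 := by
      have h1 : (z - t) * d = 0 := by
        rw [hd]
        simp only [mul_add, sub_mul, mul_sub, htt, hzz, hze', hte, htz, htz']
        abel
      rw [← ha3, mul_assoc, mul_assoc, ← mul_assoc (star a), ha1, h1, mul_zero]
    have had' : star a * d = 0 := by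
      have h1 : (x - t) * d = 0 := by
        rw [hd]
        simp only [mul_add, sub_mul, mul_sub, htt, hxz', hte, hxe, htx, htz']
        abel
      have h2 : star a * (a * star a) = star a := by
        simpa only [star_mul, star_star] using congrArg star ha3
      rw [ha2] at h2
      rw [← h2, mul_assoc, h1, mul_zero]
    clear_value d
    have hda : d * a = 0 := by simpa [hd1] using congrArg star had'
    have hda' : d * star a = 0 := by simpa [hd1] using congrArg star had
    have hf : IsStarProjection (x + (e - z)) := by
      refine ⟨?_, hx.isSelfAdjoint.add hPe.isSelfAdjoint⟩
      have hex : e * x = x := by rw [← hxz, ← mul_assoc, hze]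
      rw [IsIdempotentElem]
      simp only [add_mul, mul_add, sub_mul, mul_sub, hzz, hze, hze', hxz, hxz', hxe, hex,
        he.isIdempotentElem.eq, hx.isIdempotentElem.eq]
      abel
    have := hfin (x + (e - z)) hf (by
        rw [Projections.Below, add_mul, sub_mul, hxe, hze', he.isIdempotentElem.eq])
      ⟨a + d, by
        rw [star_add, hd1, add_mul, mul_add, mul_add, ha1, had', hda, hdd, hd]
        abel, by
        rw [star_add, hd1, add_mul, mul_add, mul_add, ha2, had, hda', hdd, hd]
        abel⟩
    have hxz2 : x = z := by
      have h2 : x = (x + (e - z)) - e + z := by abel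
      rw [h2, this]
      abel
    rw [hxz2]
  rw [mem_modularElements]
  intro X Y Z hX hY hZ hXZ
  refine (key (X ⊔ (Y ⊓ Z)) Y ((X ⊔ Y) ⊓ Z) (inf_le_right.trans hZ) ?_ ?_ ?_).ge
  · exact sup_le (le_inf le_sup_left hXZ) (inf_le_inf_right _ le_sup_right)
  · apply le_antisymm
    · exact inf_le_inf_right _ (sup_le (le_inf le_sup_left hXZ) (inf_le_inf_right _ le_sup_right))
    · refine le_inf ?_ inf_le_right
      exact le_sup_of_le_right (le_inf inf_le_right (inf_le_left.trans inf_le_right))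
  · apply le_antisymm
    · exact sup_le_sup_right (sup_le (le_inf le_sup_left hXZ) (inf_le_inf_right _ le_sup_right)) _
    · exact sup_le (inf_le_left.trans (sup_le_sup_right le_sup_left _)) le_sup_right

/-! ### Modular projections are finite -/

/-- An isometry `v` of `eR` onto a proper part `f = v v*` of `e` yields a pentagon below `e`. Write
`e₀ = e - f`, `w = v²` and let `a` be the join of the projections `wⁿ e₀ w*ⁿ`, so that `a` commutes
with `w` and is orthogonal to `b = v a v*`. The pentagon consists of `a - e₀`, of `a` and of the
graph of `(v - v*) a = v (1 - w*) a`, viewed as an operator from `a` to `b`. -/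
theorem isFinite_of_corner_mem_modularElements (hR : IsBaer R) {e : R} (he : IsStarProjection e)
    (hmod : corner e ∈ modularElements (Annihilator R)) : Projections.IsFinite e := by
  rintro f hf hfe ⟨v, hv, hvf⟩
  have hfe' := (below_comm hf he).1 hfe
  have hfe : f * e = f := hfe.symm
  have hfv : f * v = v := hvf ▸ (isStarProjection_mul_star (v := v) (hv ▸ he)).2
  have hve : v * e = v := by rw [← hv, ← mul_assoc, hvf, hfv]
  have hev : e * v = v := by rw [← hfv, ← mul_assoc, hfe']
  have hvf' : star v * f = star v := by
    simpa [hf.isSelfAdjoint.star_eq] using congrArg star hfv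
  have hev' : e * star v = star v := by
    simpa [he.isSelfAdjoint.star_eq] using congrArg star hve
  have hve' : star v * e = star v := by
    simpa [he.isSelfAdjoint.star_eq] using congrArg star hev
  set e₀ := e - f with he₀
  have hP₀ : IsStarProjection e₀ := (isStarProjection_sub hf he hfe').1
  have he₀v : e₀ * v = 0 := by rw [he₀, sub_mul, hev, hfv, sub_self]
  have hve₀ : star v * e₀ = 0 := by rw [he₀, mul_sub, hve', hvf', sub_self]
  have he₀e : e₀ * e = e₀ := by rw [he₀, sub_mul, he.isIdempotentElem.eq, hfe]
  set w := v * v with hw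
  have hwe : w * e = w := by rw [hw, mul_assoc, hve]
  have hew : e * w = w := by rw [hw, ← mul_assoc, hev]
  have hww : star w * w = e := by
    rw [hw, star_mul, mul_assoc, ← mul_assoc (star v) v, hv, hev, hv]
  have hwe' : star w * e = star w := by
    simpa [he.isSelfAdjoint.star_eq] using congrArg star hew
  have hew' : e * star w = star w := by
    simpa [he.isSelfAdjoint.star_eq] using congrArg star hwe
  have he₀w : e₀ * w = 0 := by rw [hw, ← mul_assoc, he₀v, zero_mul]
  have hwv : star w * v = star v := by rw [hw, star_mul, mul_assoc, hv, hve']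
  set E : ℕ → R := fun n => w ^ n * e₀ * star w ^ n with hE
  have hE0 : E 0 = e₀ := by simp [hE]
  have hES : ∀ n, E (n + 1) = w * E n * star w := by
    intro n
    simp only [hE, pow_succ' w, pow_succ (star w), mul_assoc]
  have hEe : ∀ n, E n * e = E n := by
    rintro (_ | n)
    · rw [hE0, he₀e]
    · rw [hES, mul_assoc, hwe']
  have hEstar : ∀ n, star (E n) = E n := by
    intro n
    simp only [hE, star_mul, star_pow, star_star, hP₀.isSelfAdjoint.star_eq, mul_assoc]
  have heE : ∀ n, e * E n = E n := by
    intro n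
    simpa [he.isSelfAdjoint.star_eq, hEstar] using congrArg star (hEe n)
  obtain ⟨a', ha', hann⟩ := hR (Set.range E)
  set a := 1 - a' with ha
  have hPa : IsStarProjection a := ha'.one_sub
  have haa := hPa.isIdempotentElem.eq
  have hsa := hPa.isSelfAdjoint.star_eq
  have hann : ∀ s, a * s = 0 ↔ ∀ n, E n * s = 0 := by
    intro s
    rw [ha, sub_mul, one_mul, sub_eq_zero, eq_comm, ← hann]
    simp
  have hae : a * e = a := by
    have : a * (1 - e) = 0 := (hann _).2 fun n => by rw [mul_sub, mul_one, hEe, sub_self]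
    rw [mul_sub, mul_one, sub_eq_zero] at this
    exact this.symm
  have hea : e * a = a := by simpa [hsa, he.isSelfAdjoint.star_eq] using congrArg star hae
  have ha1 : a * (1 - a) = 0 := by rw [mul_sub, mul_one, haa, sub_self]
  have hE1 : ∀ n, E n * (1 - a) = 0 := (hann _).1 ha1
  have hEa : ∀ n, E n * a = E n := by
    intro n
    have := hE1 n
    rw [mul_sub, mul_one, sub_eq_zero] at this
    exact this.symm
  have he₀a : e₀ * a = e₀ := hE0 ▸ hEa 0
  have hae₀ : a * e₀ = e₀ := by
    simpa [hsa, hP₀.isSelfAdjoint.star_eq] using congrArg star he₀a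
  -- `a` reduces `w`
  have haw : a * w = w * a := by
    have h1 : a * (w * (1 - a)) = 0 := by
      rw [hann]
      rintro (_ | n)
      · rw [hE0, ← mul_assoc, he₀w, zero_mul]
      · rw [hES, mul_assoc, ← mul_assoc (star w), hww, mul_assoc, ← mul_assoc (E n), hEe, hE1,
          mul_zero]
    have h2 : a * (star w * (1 - a)) = 0 := by
      rw [hann]
      intro n
      have h3 : E n * star w = star w * E (n + 1) := by
        rw [hES, ← mul_assoc, ← mul_assoc, hww, heE]
      rw [← mul_assoc, h3, mul_assoc, hE1, mul_zero]
    rw [← mul_assoc, mul_sub, mul_one, sub_eq_zero] at h1 h2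
    have h4 := congrArg star h2
    simp only [star_mul, star_star, hsa] at h4
    rw [h4, h1, mul_assoc]
  have haw' : a * star w = star w * a := by
    simpa [hsa] using (congrArg star haw).symm
  -- `v` maps `a` into its complement
  have hodd : ∀ m n, E m * (v * (w ^ n * e₀)) = 0 := by
    intro m
    induction m with
    | zero => exact fun n => by rw [hE0, ← mul_assoc, he₀v, zero_mul]
    | succ m ih =>
      rintro (_ | n)
      · rw [pow_zero, one_mul, hES, mul_assoc, ← mul_assoc (star w), hwv, hve₀, mul_zero]
      · have h1 : star w * (v * (w ^ (n + 1) * e₀)) = e * (v * (w ^ n * e₀)) := by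
          rw [← hww, pow_succ', hw]
          simp only [mul_assoc]
        rw [hES, mul_assoc, h1, mul_assoc, ← mul_assoc (E m), hEe, ih, mul_zero]
  have havE : ∀ n, a * (v * (w ^ n * e₀)) = 0 := fun n => (hann _).2 fun m => hodd m n
  have hEva : ∀ n, E n * star v * a = 0 := by
    intro n
    have h1 : a * v * E n = 0 := by
      have := congrArg (· * star w ^ n) (havE n)
      simpa only [hE, mul_assoc, zero_mul] using this
    simpa [hsa, hEstar, mul_assoc] using congrArg star h1
  have hava : a * (v * a) = 0 := by
    rw [hann]
    rintro (_ | n)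
    · rw [hE0, ← mul_assoc, he₀v, zero_mul]
    · rw [hES, mul_assoc, ← mul_assoc (star w), hwv, mul_assoc, ← mul_assoc (E n), hEva, mul_zero]
  have hava' : a * (star v * a) = 0 := by simpa [hsa, mul_assoc] using congrArg star hava
  set b := v * a * star v with hb
  have hab : a * b = 0 := by
    have : a * b = a * (v * a) * star v := by simp only [hb, mul_assoc]
    rw [this, hava, zero_mul]
  have hsb : star b = b := by simp only [hb, star_mul, star_star, hsa, mul_assoc]
  have hba : b * a = 0 := by simpa [hsa, hsb] using congrArg star hab
  have hbv : b * v = v * a := by rw [hb, mul_assoc, hv, mul_assoc, hae]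
  have hbb : b * b = b := by
    conv_lhs => rw [hb, ← mul_assoc, ← mul_assoc, hbv]
    rw [mul_assoc v, haa]
  have hbva : b * (v * a) = v * a := by rw [← mul_assoc, hbv, mul_assoc, haa]
  have hvw : v * star w * a = star v * a := by
    have h1 : v * star w = f * star v := by rw [hw, star_mul, ← mul_assoc, hvf]
    have h2 : e₀ * star v * a = 0 := hE0 ▸ hEva 0
    have h3 : f * star v = star v - e₀ * star v := by rw [he₀, sub_mul, hev']; abel
    rw [h1, h3, sub_mul, h2, sub_zero]
  have hbva' : b * (star v * a) = star v * a := by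
    have h1 : star v * a = v * (a * star w) := by rw [haw', ← mul_assoc, hvw]
    rw [h1, ← mul_assoc b, hbv, mul_assoc v, ← mul_assoc a, haa]
  have hPab : IsStarProjection (a + b) := by
    refine ⟨?_, hPa.isSelfAdjoint.add hsb⟩
    rw [IsIdempotentElem, add_mul, mul_add, mul_add, haa, hbb, hab, hba, add_zero, zero_add]
  have hP : IsStarProjection (a - e₀) := (isStarProjection_sub hP₀ hPa hae₀).1
  -- the graph is cut out by `L`, and it is the range of `G`
  set L := b - (v - star v) * a with hL
  set G := a + v * a - star v * a with hG
  set Y := corner (a + b) ⊓ ofPerp {L} with hY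
  have hYle : Y ≤ corner e := by
    refine inf_le_left.trans ((corner_le_corner hPab he).2 ?_)
    rw [Projections.Below, add_mul, hae, hb, mul_assoc (v * a), hve']
  have hLG : L * G = 0 := by
    rw [hL, hG]
    simp only [sub_mul, mul_sub, mul_add, mul_assoc, hba, hbva, hbva', haa, hava, hava']
    simp
  have hGY : G * star G ∈ Y.carrier := by
    have h1 : (a + b) * G = G := by
      rw [hG]
      simp only [add_mul, mul_add, mul_sub, haa, hava, hava', hba, hbva, hbva']
      abel
    have h2 : (a + b) * (G * star G) = G * star G := by rw [← mul_assoc, h1]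
    have h3 := congrArg star h2
    rw [star_mul, star_mul G, star_star, hPab.isSelfAdjoint.star_eq] at h3
    have h4 : L * (G * star G) = 0 := by rw [← mul_assoc, hLG, zero_mul]
    refine mem_inf.2 ⟨(mem_corner hPab).2 ⟨h2, h3⟩, ?_⟩
    rintro t rfl
    exact ⟨by rw [star_mul, star_star, h4], h4⟩
  have hYZ : Y ⊓ corner a = ⊥ := by
    rw [eq_bot_iff]
    intro s hs
    rw [mem_inf, hY, mem_inf, mem_corner hPa] at hs
    obtain ⟨⟨-, hs1⟩, hs2, -⟩ := hs
    have h1 : L * s = 0 := (hs1 L rfl).2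
    have h2 : v * s = star v * s := by
      rw [hL, sub_mul, mul_assoc _ a, hs2, sub_mul] at h1
      rw [← hs2, ← mul_assoc b, hba, zero_mul, hs2, zero_sub, neg_eq_zero, sub_eq_zero] at h1
      exact h1
    have hes : e * s = s := by rw [← hs2, ← mul_assoc, hea]
    have h3 : star w * s = s := by
      rw [hw, star_mul, mul_assoc, ← h2, ← mul_assoc, hv, hes]
    have h3' : star s * w = star s := by simpa using congrArg star h3
    -- a fixed point of `w*` is a fixed point of the isometry `w`
    have h4 : w * s = s := by
      rw [← sub_eq_zero, ← CStarRing.star_mul_self_eq_zero_iff]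
      have : star (w * s - s) * (w * s - s) = star s * (star w * w * s) - star s * (star w * s)
          - star s * w * s + star s * s := by
        simp only [star_sub, star_mul, sub_mul, mul_sub, mul_assoc]
        abel
      rw [this, hww, hes, h3, h3']
      abel
    have h5 : a * s = 0 := by
      rw [hann]
      intro n
      induction n with
      | zero => rw [hE0, ← h4, ← mul_assoc, he₀w, zero_mul]
      | succ n ih => rw [hES, mul_assoc, h3, mul_assoc, ih, mul_zero]
    rw [← hs2, h5]
  have hle : corner a ≤ corner (a - e₀) ⊔ Y := by
    rw [← CompleteOrtholattice.compl_compl (corner (a - e₀) ⊔ Y),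
      CompleteOrtholattice.le_compl_comm, CompleteOrtholattice.compl_sup]
    have key : ∀ s ∈ ((corner (a - e₀))ᶜ ⊓ Yᶜ).carrier, a * s = 0 := by
      intro s hs
      rw [mem_inf, mem_corner_compl hP] at hs
      have h1 : star G * s = 0 := by
        have := mul_eq_zero hGY hs.2
        rw [← CStarRing.star_mul_self_eq_zero_iff, star_mul, star_star, mul_assoc,
          ← mul_assoc G, this, mul_zero]
      set α := a * s with hα
      have hα' : α = e₀ * s := by
        have := hs.1.1
        rwa [sub_mul, sub_eq_zero] at this
      set β := a * (star v * s) with hβ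
      have h2 : a * (v * s) = w * β := by
        have h3 : a * v * b = a * v := by
          have := congrArg star hbva'
          simpa only [star_mul, star_star, hsa, hsb] using this
        calc a * (v * s) = a * v * b * s := by rw [h3, mul_assoc]
          _ = a * w * (a * (star v * s)) := by rw [hb, hw]; simp only [mul_assoc]
          _ = w * β := by rw [haw, mul_assoc, ← mul_assoc a, haa]
      have h4 : w * β = α + β := by
        rw [hG, star_sub, star_add, star_mul, star_mul, star_star, hsa, sub_mul, add_mul,
          mul_assoc, mul_assoc, h2, sub_eq_zero] at h1
        exact h1.symm
      have heβ : e * β = β := by rw [hβ, ← mul_assoc, hea]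
      -- `w` is isometric on `β`, and `w β` is orthogonal to `α`
      have h5 : star α * (α + β) = 0 := by
        rw [← h4, hα', star_mul, hP₀.isSelfAdjoint.star_eq, mul_assoc, ← mul_assoc e₀, he₀w,
          zero_mul, mul_zero]
      have h6 : star (α + β) * (α + β) = star β * β := by
        rw [← h4, star_mul, mul_assoc, ← mul_assoc (star w), hww, heβ]
      have h5' := congrArg star h5
      rw [star_mul, star_star, star_zero, star_add, add_mul] at h5'
      rw [star_add, add_mul, h5, zero_add, mul_add] at h6
      have h7 : star β * α = 0 := by
        have : star β * α + star β * β - star β * β = 0 := by rw [h6, sub_self]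
        simpa using this
      rw [h7, add_zero] at h5'
      exact (CStarRing.star_mul_self_eq_zero_iff α).1 h5'
    intro s hs
    rw [mem_corner_compl hPa]
    refine ⟨key s hs, ?_⟩
    simpa [hsa] using congrArg star (key _ (star_mem hs))
  have hZe : corner a ≤ corner e := (corner_le_corner hPa he).2 hae.symm
  have hXZ : corner (a - e₀) ≤ corner a := (corner_le_corner hP hPa).2
    (by rw [Projections.Below, sub_mul, haa, he₀a])
  have h1 := mem_modularElements.1 hmod (corner (a - e₀)) Y (corner a) (hXZ.trans hZe) hYle hZe hXZ
  rw [inf_eq_right.2 hle, hYZ, sup_bot_eq, corner_le_corner hPa hP, Projections.Below, mul_sub,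
    haa, hae₀, eq_comm, sub_eq_self, he₀, sub_eq_zero] at h1
  exact h1.symm

end Annihilator

namespace VonNeumannAlgebra

open CompleteOrtholattice

variable {H : Type*} [NormedAddCommGroup H] [InnerProductSpace ℂ H] [CompleteSpace H]

/-! ### Von Neumann algebras are Baer `*`-rings with polar decomposition -/

theorem mem_of_forall_commute (M : VonNeumannAlgebra H) {x : H →L[ℂ] H}
    (h : ∀ y ∈ M.commutant, y * x = x * y) : x ∈ M := by
  rw [← M.commutant_commutant, mem_commutant_iff]
  exact h

theorem commute_of_mem {M : VonNeumannAlgebra H} {x y : H →L[ℂ] H} (hx : x ∈ M)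
    (hy : y ∈ M.commutant) : x * y = y * x :=
  mem_commutant_iff.1 hy x hx

/-- The projection onto the common kernel of a set of operators in `M` belongs to `M`. -/
theorem exists_isStarProjection_forall_mul_eq_zero_iff (M : VonNeumannAlgebra H)
    (T : Set (H →L[ℂ] H)) (hT : T ⊆ M) :
    ∃ p ∈ M, IsStarProjection p ∧ ∀ s : H →L[ℂ] H, (∀ t ∈ T, t * s = 0) ↔ p * s = s := by
  let K : Submodule ℂ H := ⨅ t ∈ T, (t : H →L[ℂ] H).ker
  have hmem : ∀ η, η ∈ K ↔ ∀ t ∈ T, t η = 0 := by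
    intro η
    simp [K, Submodule.mem_iInf]
  have hclosed : IsClosed (K : Set H) := by
    have : (K : Set H) = ⋂ t ∈ T, {η | t η = 0} := by
      ext η
      simp [hmem]
    rw [this]
    exact isClosed_biInter fun t _ => isClosed_eq t.continuous continuous_const
  have : CompleteSpace K := hclosed.completeSpace_coe
  have hP : IsStarProjection K.starProjection := isStarProjection_starProjection
  refine ⟨K.starProjection, ?_, hP, fun s => ?_⟩
  · rw [IsStarProjection.mem_iff hP]
    intro y hy
    rw [Submodule.range_starProjection, Module.End.mem_invtSubmodule]
    intro η hη
    change y η ∈ K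
    rw [hmem] at *
    intro t ht
    have := congrArg (· η) (commute_of_mem (hT ht) hy)
    simpa [hη t ht] using this
  · rw [ContinuousLinearMap.ext_iff]
    simp only [mul_apply_eq_comp, Submodule.starProjection_eq_self_iff, hmem]
    constructor
    · exact fun h η t ht => congrArg (· η) (h t ht)
    · exact fun h t ht => ContinuousLinearMap.ext fun η => h η t ht

theorem isBaer (M : VonNeumannAlgebra H) : Annihilator.IsBaer M := by
  intro T
  obtain ⟨p, hpM, hp, h⟩ := M.exists_isStarProjection_forall_mul_eq_zero_iff
    ((fun t : M => (t : H →L[ℂ] H)) '' T) (by rintro _ ⟨t, _, rfl⟩; exact t.2)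
  refine ⟨⟨p, hpM⟩, ⟨Subtype.ext hp.isIdempotentElem, Subtype.ext hp.isSelfAdjoint⟩, fun s => ?_⟩
  constructor
  · intro hs
    refine Subtype.ext ((h s).1 ?_)
    rintro _ ⟨t, ht, rfl⟩
    exact congrArg Subtype.val (hs t ht)
  · exact fun hs t ht => Subtype.ext ((h s).2 (congrArg Subtype.val hs) _ ⟨t, ht, rfl⟩)

theorem abs_mem {M : VonNeumannAlgebra H} {x : H →L[ℂ] H} (hx : x ∈ M) : CFC.abs x ∈ M :=
  mem_of_forall_commute M fun _ hy =>
    (Commute.cfcAbs_right (commute_of_mem hx hy) (commute_of_mem hx (star_mem hy))).eq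

theorem hasAbs (M : VonNeumannAlgebra H) : Annihilator.HasAbs M := fun x =>
  ⟨⟨CFC.abs (x : H →L[ℂ] H), abs_mem x.2⟩,
    Subtype.ext (CFC.abs_nonneg (x : H →L[ℂ] H)).isSelfAdjoint.star_eq,
    Subtype.ext (CFC.abs_mul_abs (x : H →L[ℂ] H))⟩

/-- If `‖x η‖ = ‖k η‖` for all `η`, then `x = v k` for a bounded `v`. -/
theorem exists_mul_eq_of_norm_eq {x k : H →L[ℂ] H} (h : ∀ η, ‖x η‖ = ‖k η‖) :
    ∃ v : H →L[ℂ] H, v * k = x := by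
  let K : Submodule ℂ H := k.range.topologicalClosure
  have : CompleteSpace K := (Submodule.isClosed_topologicalClosure _).completeSpace_coe
  have hk : ∀ η, k η ∈ K := fun η => Submodule.le_topologicalClosure _ ⟨η, rfl⟩
  let e : H →ₗ[ℂ] K := LinearMap.codRestrict K k hk
  have he : DenseRange e := by
    intro κ
    have hκ : (κ : H) ∈ closure (Set.range k) := κ.2
    rw [closure_subtype]
    convert hκ using 2
    ext η
    simp only [Set.mem_image, Set.mem_range, exists_exists_eq_and]
    rfl
  have hbound : ∃ C, ∀ η, ‖(x : H →ₗ[ℂ] H) η‖ ≤ C * ‖e η‖ :=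
    ⟨1, fun η => by rw [one_mul]; exact (h η).le⟩
  refine ⟨(LinearMap.extendOfNorm (x : H →ₗ[ℂ] H) e).comp K.orthogonalProjectionOnto, ?_⟩
  ext η
  have h1 : K.orthogonalProjectionOnto (k η) = e η :=
    Submodule.orthogonalProjectionOnto_mem_subspace_eq_self (⟨k η, hk η⟩ : K)
  have h2 := LinearMap.extendOfNorm_eq he hbound η
  simpa [h1] using h2

theorem norm_abs_apply (x : H →L[ℂ] H) (η : H) : ‖x η‖ = ‖CFC.abs x η‖ := by
  have h : inner ℂ (x η) (x η) = inner ℂ (CFC.abs x η) (CFC.abs x η) := by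
    rw [← ContinuousLinearMap.adjoint_inner_right, ← ContinuousLinearMap.adjoint_inner_right]
    have h1 := congrArg (· η) (CFC.abs_mul_abs x)
    have h2 := (CFC.abs_nonneg x).isSelfAdjoint.star_eq
    rw [ContinuousLinearMap.star_eq_adjoint] at h1 h2
    simp only [mul_apply_eq_comp] at h1
    rw [h2, h1]
  rw [inner_self_eq_norm_sq_to_K, inner_self_eq_norm_sq_to_K] at h
  have h' : ‖x η‖ ^ 2 = ‖CFC.abs x η‖ ^ 2 := by exact_mod_cast h
  exact (sq_eq_sq₀ (norm_nonneg _) (norm_nonneg _)).1 h'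

/-- Polar decomposition in a von Neumann algebra. -/
theorem hasPolar (M : VonNeumannAlgebra H) : Annihilator.HasPolar M := by
  intro x
  obtain ⟨v₀, hv₀⟩ := exists_mul_eq_of_norm_eq (norm_abs_apply (x : H →L[ℂ] H))
  have hkM : CFC.abs (x : H →L[ℂ] H) ∈ M := abs_mem x.2
  have hks := (CFC.abs_nonneg (x : H →L[ℂ] H)).isSelfAdjoint.star_eq
  have hkk := CFC.abs_mul_abs (x : H →L[ℂ] H)
  set k := CFC.abs (x : H →L[ℂ] H) with hk
  obtain ⟨q, hqM, hq, hqk⟩ := M.exists_isStarProjection_forall_mul_eq_zero_iff {k}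
    (by rintro _ rfl; exact hkM)
  simp only [Set.mem_singleton_iff, forall_eq] at hqk
  -- `P` is the support of `|x|`
  set P := 1 - q with hPdef
  have hP : IsStarProjection P := hq.one_sub
  have hPM : P ∈ M := sub_mem (one_mem M) hqM
  have hPk : ∀ s, k * s = 0 ↔ P * s = 0 := by
    intro s
    rw [hqk, hPdef, sub_mul, one_mul, sub_eq_zero, eq_comm]
  have hkP : k * P = k := by
    have := (hPk (1 - P)).2 (by rw [mul_sub, mul_one, hP.isIdempotentElem.eq, sub_self])
    rw [mul_sub, mul_one, sub_eq_zero] at this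
    exact this.symm
  have hPk' : P * k = k := by
    simpa [hks, hP.isSelfAdjoint.star_eq] using congrArg star hkP
  have hright : ∀ t : H →L[ℂ] H, t * k = 0 → t * P = 0 := by
    intro t ht
    have h1 := (hPk (star t)).1 (by simpa [hks] using congrArg star ht)
    simpa [hP.isSelfAdjoint.star_eq] using congrArg star h1
  have hvM : v₀ * P ∈ M := by
    refine mem_of_forall_commute M fun y hy => ?_
    have h1 : (y * v₀ - v₀ * y) * k = 0 := by
      rw [sub_mul, mul_assoc, hv₀, mul_assoc, ← commute_of_mem hkM hy, ← mul_assoc v₀, hv₀,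
        commute_of_mem x.2 hy, sub_self]
    have h2 := hright _ h1
    rw [sub_mul, sub_eq_zero] at h2
    rw [← mul_assoc, h2, mul_assoc, ← commute_of_mem hPM hy, mul_assoc]
  set v := v₀ * P with hv
  have hvk : v * k = x := by rw [hv, mul_assoc, hPk', hv₀]
  have hvP : v * P = v := by rw [hv, mul_assoc, hP.isIdempotentElem.eq]
  have hPv : P * star v = star v := by
    simpa [hP.isSelfAdjoint.star_eq] using congrArg star hvP
  have hx : star (x : H →L[ℂ] H) = k * star v := by rw [← hvk, star_mul, hks]
  have hvx : star v * x = k := by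
    have h1 : k * (star v * x - k) = 0 := by rw [mul_sub, ← mul_assoc, ← hx, hkk, sub_self]
    rw [hPk, mul_sub, ← mul_assoc, hPv, hPk', sub_eq_zero] at h1
    exact h1
  have hvv : star v * v = P := by
    have h1 : (star v * v - 1) * k = 0 := by rw [sub_mul, mul_assoc, hvk, hvx, one_mul, sub_self]
    have h2 := hright _ h1
    rw [sub_mul, mul_assoc, hvP, one_mul, sub_eq_zero] at h2
    exact h2
  have hzero : ∀ s : H →L[ℂ] H, v * s = 0 ↔ (x : H →L[ℂ] H) * s = 0 := by
    intro s
    constructor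
    · intro h
      have h1 : P * s = 0 := by rw [← hvv, mul_assoc, h, mul_zero]
      rw [← hvk, mul_assoc, (hPk s).2 h1, mul_zero]
    · intro h
      have h1 : k * s = 0 := by rw [← hvx, mul_assoc, h, mul_zero]
      rw [← hvP, mul_assoc, (hPk s).1 h1, mul_zero]
  have hzero' : ∀ s : H →L[ℂ] H, star v * s = 0 ↔ star (x : H →L[ℂ] H) * s = 0 := by
    intro s
    rw [hx, mul_assoc, hPk, ← mul_assoc, hPv]
  refine ⟨⟨v, hvM⟩, ?_, fun s => ?_, fun s => ?_⟩
  · have : star (⟨v, hvM⟩ : M) * ⟨v, hvM⟩ = ⟨P, hPM⟩ := Subtype.ext hvv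
    rw [this]
    exact ⟨Subtype.ext hP.isIdempotentElem, Subtype.ext hP.isSelfAdjoint⟩
  · exact ⟨fun h => Subtype.ext ((hzero s).1 (congrArg Subtype.val h)),
      fun h => Subtype.ext ((hzero s).2 (congrArg Subtype.val h))⟩
  · exact ⟨fun h => Subtype.ext ((hzero' s).1 (congrArg Subtype.val h)),
      fun h => Subtype.ext ((hzero' s).2 (congrArg Subtype.val h))⟩

/-! ### Commutation with projections -/

/-- A positive contraction `a` splits as `2 a = e + a'` with a projection `e` and a positive
contraction `a'`: the support `e` of `(2 a - 1)⁺` is the first binary digit of `a`. -/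
theorem exists_isStarProjection_two_mul_sub {M : VonNeumannAlgebra H} {a p : H →L[ℂ] H}
    (ha : a ∈ M) (hpa : Commute a p) (h0 : 0 ≤ a) (h1 : a ≤ 1) (hp : IsStarProjection p) :
    ∃ e ∈ M, IsStarProjection e ∧ Commute e p ∧ 0 ≤ 2 * a - e ∧ 2 * a - e ≤ 1 := by
  set h := 2 * a - 1 with hh
  have hs : IsSelfAdjoint h := by
    rw [hh, two_mul]
    exact ((IsSelfAdjoint.of_nonneg h0).add (IsSelfAdjoint.of_nonneg h0)).sub (IsSelfAdjoint.one _)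
  have hcomm : ∀ y, Commute a y → Commute h⁺ y := by
    intro y hy
    refine Commute.cfcₙ_real ?_ _
    rw [hh, two_mul]
    exact (hy.add_left hy).sub_left (Commute.one_left y)
  have hM : h⁺ ∈ M := mem_of_forall_commute M fun y hy => (hcomm y (commute_of_mem ha hy)).eq.symm
  obtain ⟨k, hkM, hk, hk'⟩ := M.exists_isStarProjection_forall_mul_eq_zero_iff {h⁺}
    (by rintro _ rfl; exact hM)
  simp only [Set.mem_singleton_iff, forall_eq] at hk'
  have hkk := hk.isIdempotentElem.eq
  have hks := hk.isSelfAdjoint.star_eq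
  have hps := hp.isSelfAdjoint.star_eq
  have hPs := (CFC.posPart_nonneg h).isSelfAdjoint.star_eq
  have hPk : h⁺ * k = 0 := (hk' k).2 hkk
  have hkP : k * h⁺ = 0 := by simpa [hks, hPs] using congrArg star hPk
  have hkN : k * h⁻ = h⁻ := (hk' _).1 (CFC.posPart_mul_negPart h)
  have hNk : h⁻ * k = h⁻ := by
    simpa [hks, (CFC.negPart_nonneg h).isSelfAdjoint.star_eq] using congrArg star hkN
  have hdec : h⁺ - h⁻ = h := CFC.posPart_sub_negPart h hs
  have hkp : Commute k p := by
    have h2 : k * (p * k) = p * k := by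
      rw [← hk', ← mul_assoc, (hcomm p hpa).eq, mul_assoc, hPk, mul_zero]
    have h3 := congrArg star h2
    simp only [star_mul, hks, hps] at h3
    rw [Commute, SemiconjBy, ← h2, ← mul_assoc, h3]
  have e1 : 2 * a = h⁺ - h⁻ + 1 := by rw [hdec, hh]; abel
  refine ⟨1 - k, sub_mem (one_mem M) hkM, hk.one_sub, (Commute.one_left p).sub_left hkp, ?_, ?_⟩
  · have h2 : 2 * a - (1 - k) = h⁺ + k * (2 * a) * k := by
      rw [e1]
      simp only [mul_add, mul_sub, add_mul, sub_mul, hkP, hkN, hNk, mul_one, hkk, zero_mul]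
      abel
    have h3 : 0 ≤ k * (2 * a) * k := by
      have : (0 : H →L[ℂ] H) ≤ 2 * a := by rw [two_mul]; exact add_nonneg h0 h0
      exact hk.isSelfAdjoint.conjugate_nonneg this
    rw [h2]
    exact add_nonneg (CFC.posPart_nonneg h) h3
  · have h2 : 1 - (2 * a - (1 - k)) = (1 - k) * (2 * (1 - a)) * (1 - k) + h⁻ := by
      have e2 : 2 * (1 - a) = 1 - h⁺ + h⁻ := by
        rw [mul_sub, e1, mul_one, ← one_add_one_eq_two]
        abel
      rw [e2, e1]
      simp only [mul_add, mul_sub, add_mul, sub_mul, hkP, hPk, hkN, hNk, mul_one, one_mul, hkk, zero_mul]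
      abel
    have h3 : 0 ≤ (1 - k) * (2 * (1 - a)) * (1 - k) := by
      have : (0 : H →L[ℂ] H) ≤ 2 * (1 - a) := by
        rw [two_mul]; exact add_nonneg (sub_nonneg.2 h1) (sub_nonneg.2 h1)
      exact hk.one_sub.isSelfAdjoint.conjugate_nonneg this
    rw [← sub_nonneg, h2]
    exact add_nonneg h3 (CFC.negPart_nonneg h)

/-- Iterating the binary expansion, the commutator of `b` with a positive contraction is at most
half as large as that with another one, as `b` commutes with the binary digits. -/
theorem norm_commutator_le {M : VonNeumannAlgebra H} {p b : H →L[ℂ] H} (hp : IsStarProjection p)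
    (hb : ∀ e ∈ M, IsStarProjection e → Commute e p → Commute e b) (n : ℕ) :
    ∀ a ∈ M, Commute a p → 0 ≤ a → a ≤ 1 → 2 ^ n * ‖a * b - b * a‖ ≤ 2 * ‖b‖ := by
  induction n with
  | zero =>
    intro a _ _ h0 h1
    have ha : ‖a‖ ≤ 1 := (CStarAlgebra.norm_le_one_iff_of_nonneg a h0).2 h1
    have h2 : ‖a * b‖ ≤ ‖b‖ := (norm_mul_le a b).trans (mul_le_of_le_one_left (norm_nonneg b) ha)
    have h3 : ‖b * a‖ ≤ ‖b‖ := (norm_mul_le b a).trans (mul_le_of_le_one_right (norm_nonneg b) ha)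
    rw [pow_zero, one_mul]
    linarith [norm_sub_le (a * b) (b * a)]
  | succ n ih =>
    intro a ha hap h0 h1
    obtain ⟨e, heM, he, hep, h2, h3⟩ := exists_isStarProjection_two_mul_sub ha hap h0 h1 hp
    have hmem : 2 * a - e ∈ M := by rw [two_mul]; exact sub_mem (add_mem ha ha) heM
    have hcomm : Commute (2 * a - e) p := by rw [two_mul]; exact (hap.add_left hap).sub_left hep
    have h4 := ih _ hmem hcomm h2 h3
    have h5 : (2 * a - e) * b - b * (2 * a - e) = (2 : ℂ) • (a * b - b * a) := by
      rw [sub_mul, mul_sub, (hb e heM he hep).eq, two_smul, two_mul, add_mul, mul_add]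
      abel
    rw [h5, norm_smul, Complex.norm_two, ← mul_assoc, ← pow_succ] at h4
    exact h4

/-- An operator that commutes with all projections of `M` which commute with `p` commutes with all
elements of `M` which commute with `p`. -/
theorem commute_of_forall_isStarProjection {M : VonNeumannAlgebra H} {p b : H →L[ℂ] H}
    (hp : IsStarProjection p) (hb : ∀ e ∈ M, IsStarProjection e → Commute e p → Commute e b)
    {x : H →L[ℂ] H} (hx : x ∈ M) (hxp : Commute x p) : Commute x b := by
  have hpos : ∀ a ∈ M, Commute a p → 0 ≤ a → a ≤ 1 → Commute a b := by
    intro a ha hap h0 h1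
    by_contra hne
    have hpos : 0 < ‖a * b - b * a‖ := norm_pos_iff.2 (sub_ne_zero.2 hne)
    obtain ⟨n, hn⟩ := pow_unbounded_of_one_lt (2 * ‖b‖ / ‖a * b - b * a‖) one_lt_two
    rw [div_lt_iff₀ hpos] at hn
    exact absurd (norm_commutator_le hp hb n a ha hap h0 h1) (not_le.2 hn)
  have hsmul : ∀ (c : ℂ) (y : H →L[ℂ] H), y ∈ M → c • y ∈ M := fun c y hy =>
    M.toStarSubalgebra.smul_mem hy c
  -- a self-adjoint element is an affine image of a positive contraction
  have hsa : ∀ a ∈ M, Commute a p → IsSelfAdjoint a → Commute a b := by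
    intro a ha hap hs
    set c : ℝ := ‖a‖ + 1 with hc
    have hc0 : 0 < c := by positivity
    have hle : a ≤ algebraMap ℝ (H →L[ℂ] H) c :=
      (IsSelfAdjoint.le_algebraMap_norm_self hs).trans
        (algebraMap_mono _ (by rw [hc]; linarith))
    have hge : -a ≤ algebraMap ℝ (H →L[ℂ] H) c := by
      have := IsSelfAdjoint.le_algebraMap_norm_self hs.neg
      rw [norm_neg] at this
      exact this.trans (algebraMap_mono _ (by rw [hc]; linarith))
    rw [Algebra.algebraMap_eq_smul_one] at hle hge
    have h2c : (0 : ℝ) ≤ (2 * c)⁻¹ := by positivity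
    have key := hpos ((2 * c)⁻¹ • (a + c • 1)) ?_ ?_ ?_ ?_
    · have h1 : a = (2 * c) • ((2 * c)⁻¹ • (a + c • 1)) - c • (1 : H →L[ℂ] H) := by
        rw [smul_smul, mul_inv_cancel₀ (by positivity), one_smul, add_sub_cancel_right]
      rw [h1]
      exact (key.smul_left _).sub_left ((Commute.one_left b).smul_left c)
    · have : (2 * c)⁻¹ • (a + c • (1 : H →L[ℂ] H)) =
          (((2 * c)⁻¹ : ℝ) : ℂ) • (a + ((c : ℝ) : ℂ) • (1 : H →L[ℂ] H)) := by
        simp only [Complex.coe_smul]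
      rw [this]
      exact hsmul _ _ (add_mem ha (hsmul _ _ (one_mem M)))
    · exact (hap.add_left ((Commute.one_left p).smul_left c)).smul_left _
    · exact smul_nonneg h2c (neg_le_iff_add_nonneg'.1 hge)
    · calc (2 * c)⁻¹ • (a + c • (1 : H →L[ℂ] H)) ≤ (2 * c)⁻¹ • (c • 1 + c • 1) :=
            smul_le_smul_of_nonneg_left (add_le_add_left hle _) h2c
        _ = 1 := by rw [← add_smul, ← two_mul, smul_smul, inv_mul_cancel₀ (by positivity), one_smul]
  have hstar : Commute (star x) p := by
    have := hxp.star_star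
    rwa [hp.isSelfAdjoint.star_eq] at this
  have hre := hsa (x + star x) (add_mem hx (star_mem hx)) (hxp.add_left hstar)
    (IsSelfAdjoint.add_star_self x)
  have him := hsa (Complex.I • (x - star x)) (hsmul _ _ (sub_mem hx (star_mem hx)))
    ((hxp.sub_left hstar).smul_left _) (by
      rw [IsSelfAdjoint, star_smul, star_sub, star_star]
      simp [← smul_neg])
  have h2 : x = (2⁻¹ : ℂ) • ((x + star x) - Complex.I • (Complex.I • (x - star x))) := by
    rw [smul_smul, Complex.I_mul_I, neg_one_smul, sub_neg_eq_add, add_add_sub_cancel, ← two_smul ℂ,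
      smul_smul]
    simp
  rw [h2]
  exact (hre.sub_left (him.smul_left _)).smul_left _

end VonNeumannAlgebra

namespace VonNeumannAlgebra

open CompleteOrtholattice

variable {H : Type*} [NormedAddCommGroup H] [InnerProductSpace ℂ H] [CompleteSpace H]

/-! ### The classical type decomposition -/

open Annihilator in
theorem isAbelian_of_corner_mem_distributiveElements {M : VonNeumannAlgebra H} {p : M}
    (hp : IsStarProjection p) (hD : corner p ∈ distributiveElements (Annihilator M)) :
    Projections.IsAbelian p := by
  have hp' : IsStarProjection (p : H →L[ℂ] H) :=
    ⟨congrArg Subtype.val hp.isIdempotentElem, congrArg Subtype.val hp.isSelfAdjoint⟩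
  have hmem : ∀ a : M, p * a * p ∈ (corner p).carrier := fun a =>
    mul_mul_mem (self_mem_corner hp) (self_mem_corner hp) a
  intro a b
  have key := commute_of_forall_isStarProjection (M := M) (b := ((p * b * p : M) : H →L[ℂ] H)) hp'
    (fun e heM he hep => ?_) (x := ((p * a * p : M) : H →L[ℂ] H)) (p * a * p : M).2 ?_
  · exact Subtype.ext key
  · exact congrArg Subtype.val (commute_of_corner_mem_distributiveElements M.hasAbs hp hD
      (e := ⟨e, heM⟩) ⟨Subtype.ext he.isIdempotentElem, Subtype.ext he.isSelfAdjoint⟩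
      (Subtype.ext hep) (hmem b))
  · have h := (mem_corner hp).1 (hmem a)
    exact congrArg Subtype.val (h.2.trans h.1.symm)

open Annihilator in
theorem typeIV_eq_bot (M : VonNeumannAlgebra H) : typeIV (Annihilator M) = ⊥ := by
  have h : typeCover (orthomodularElements (Annihilator M)) = ⊤ :=
    top_le_iff.1 ((le_centralCover _).trans
      (le_sSup ⟨⊤, M.isBaer.top_mem_orthomodularElements, rfl⟩))
  rw [typeIV, h, CompleteOrtholattice.compl_top]

open Annihilator in
/-- The type decomposition of the ortholattice of annihilators is the classical one, as the
abelian and the finite projections correspond to the distributive and the modular elements. -/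
theorem exists_isClassicalTypeDecomposition (M : VonNeumannAlgebra H) :
    ∃ z₁ z₂ z₃ : M, Projections.IsClassicalTypeDecomposition z₁ z₂ z₃ ∧
      (typePart M 0).carrier = {a : M | z₁ * a = a} ∧
      (typePart M 1).carrier = {a : M | z₂ * a = a} ∧
      (typePart M 2).carrier = {a : M | z₃ * a = a} ∧
      (typePart M 3).carrier = {0} := by
  have hP := hasContinuousCenter M.hasAbs
  have hD := hP.isTypeIdeal_distributiveElements
  have hM := hP.isTypeIdeal_modularElements
  have hI := isIdeal_typePart M.hasAbs
  choose z hz hzB using fun i => M.isBaer.exists_eq_corner (typePart M i)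
  have hc : ∀ i, Projections.IsCentralProjection (z i) := fun i =>
    IsIdeal.isCentralProjection (hz i) (hzB i ▸ hI i)
  have hcar : ∀ i, (typePart M i).carrier = {a : M | z i * a = a} := by
    intro i
    ext a
    rw [hzB i, mem_corner (hz i), Set.mem_ofPred_eq, ← (hc i).2, and_self]
  have horth : ∀ i j, i ≠ j → z i * z j = 0 := fun i j hij =>
    (starPerp_of_orth (orth_typePart hij) (hzB i ▸ self_mem_corner (hz i))
      (hzB j ▸ self_mem_corner (hz j))).2
  have hle : ∀ (e : M), IsStarProjection e → ∀ i, Projections.Below e (z i) →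
      corner e ≤ typePart M i := by
    intro e he i h
    rw [hzB i]
    exact (corner_le_corner he (hz i)).2 h
  have hbelow : ∀ (w : M), Projections.IsCentralProjection w → w ≠ 0 → ∀ T, IsTypeIdeal T →
      corner w ≤ typeCover T → ∃ e : M, IsStarProjection e ∧ Projections.Below e w ∧ e ≠ 0 ∧
        corner e ∈ T := by
    intro w hw hw0 T hT hwT
    obtain ⟨t, ht, htw, ht0⟩ := hT.exists_mem_le (isIdeal_corner hw).isCentral hwT
      (fun h => hw0 ((corner_eq_bot hw.1).1 h))
    obtain ⟨e, he, rfl⟩ := M.isBaer.exists_eq_corner t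
    exact ⟨e, he, (corner_le_corner he hw.1).1 htw, fun h => ht0 ((corner_eq_bot he).2 h), ht⟩
  have hzero : ∀ (e : M), IsStarProjection e → ∀ T, corner e ∈ T →
      corner e ≤ (typeCover T)ᶜ → e = 0 := by
    intro e he T heT h
    rw [← corner_eq_bot he]
    exact le_bot_of_le_compl (q := typeCover T)
      ((le_centralCover _).trans (le_sSup ⟨corner e, heT, rfl⟩)) h
  refine ⟨z 0, z 1, z 2, ⟨hc 0, hc 1, hc 2, horth _ _ (by decide), horth _ _ (by decide),
    horth _ _ (by decide), ?_, ?_, ⟨?_, ?_⟩, ?_⟩, hcar 0, hcar 1, hcar 2, ?_⟩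
  · rw [← sub_eq_zero, ← neg_eq_zero, neg_sub]
    refine eq_zero_of_forall_mem_typePart_compl M.hasAbs fun i => ?_
    have h3 : z 3 = 0 := (corner_eq_bot (hz 3)).1 ((hzB 3).symm.trans M.typeIV_eq_bot)
    have hsa : star (1 - (z 0 + z 1 + z 2)) = 1 - (z 0 + z 1 + z 2) := by
      simp only [star_sub, star_one, star_add, (hz _).isSelfAdjoint.star_eq]
    have hkill : z i * (1 - (z 0 + z 1 + z 2)) = 0 := by
      rw [mul_sub, mul_add, mul_add, mul_one]
      fin_cases i
      · simp [horth, (hz 0).isIdempotentElem.eq]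
      · simp [horth, (hz 1).isIdempotentElem.eq]
      · simp [horth, (hz 2).isIdempotentElem.eq]
      · simp [h3]
    rw [hzB i, mem_corner_compl (hz i), ← (hc i).2]
    exact ⟨hkill, hkill⟩
  · intro w hw hwz hw0
    obtain ⟨e, he, hew, he0, heD⟩ := hbelow w hw hw0 _ hD (hle w hw.1 0 hwz)
    exact ⟨e, he, hew, he0, isAbelian_of_corner_mem_distributiveElements he heD⟩
  · intro e he hez heab
    exact hzero e he _ (corner_mem_distributiveElements he heab)
      ((hle e he 1 hez).trans inf_le_left)
  · intro w hw hwz hw0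
    obtain ⟨e, he, hew, he0, heM⟩ := hbelow w hw hw0 _ hM ((hle w hw.1 1 hwz).trans inf_le_right)
    exact ⟨e, he, hew, he0, isFinite_of_corner_mem_modularElements M.isBaer he heM⟩
  · intro e he hez hefin
    exact hzero e he _ (corner_mem_modularElements M.isBaer M.hasPolar he hefin)
      ((hle e he 2 hez).trans inf_le_left)
  · change (typeIV (Annihilator M)).carrier = {0}
    rw [M.typeIV_eq_bot, carrier_bot]

end VonNeumannAlgebra

theorem mainTheorem1 :
    (∀ (A : Type*) [NonUnitalCStarAlgebra A],
      (∀ T ∈ ({CompleteOrtholattice.distributiveElements (Annihilator A),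
          CompleteOrtholattice.modularElements (Annihilator A),
          CompleteOrtholattice.orthomodularElements (Annihilator A)} : Set (Set (Annihilator A))),
        CompleteOrtholattice.IsTypeIdeal T ∧
        ∀ q : Annihilator A,
          CompleteOrtholattice.IsTypeCover T q ↔ q = CompleteOrtholattice.typeCover T) ∧
      (∀ i, IsClosedIdeal (typePart A i).carrier) ∧
      (∀ i j, i ≠ j → ∀ a ∈ (typePart A i).carrier, ∀ b ∈ (typePart A j).carrier, StarPerp a b) ∧
      IsDirect (fun i => (typePart A i).carrier) ∧
      IsClosedIdeal (sumSet fun i => (typePart A i).carrier) ∧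
      IsEssential (sumSet fun i => (typePart A i).carrier)) ∧
    (∀ (H : Type*) [NormedAddCommGroup H] [InnerProductSpace ℂ H] [CompleteSpace H]
      (M : VonNeumannAlgebra H),
      ∃ z₁ z₂ z₃ : M, Projections.IsClassicalTypeDecomposition z₁ z₂ z₃ ∧
        (typePart M 0).carrier = {a : M | z₁ * a = a} ∧
        (typePart M 1).carrier = {a : M | z₂ * a = a} ∧
        (typePart M 2).carrier = {a : M | z₃ * a = a} ∧
        (typePart M 3).carrier = {0}) := by
  refine ⟨fun A _ => ?_, fun H _ _ _ M => M.exists_isClassicalTypeDecomposition⟩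
  have hA := Annihilator.hasAbs_of_nonUnitalCStarAlgebra A
  have hI := Annihilator.isIdeal_typePart hA
  have hO : ∀ i j : Fin 4, i ≠ j → CompleteOrtholattice.Orth (typePart A i) (typePart A j) :=
    fun i j => Annihilator.orth_typePart
  refine ⟨fun T hT => ?_, fun i => (hI i).isClosedIdeal, fun i j hij a ha b hb =>
    Annihilator.starPerp_of_orth (hO i j hij) ha hb, Annihilator.isDirect_of_orth hO,
    Annihilator.isClosedIdeal_sumSet hO hI, Annihilator.isEssential_sumSet_typePart⟩
  have h := Annihilator.isTypeIdeal_of_mem hA hT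
  exact ⟨h, fun q => (Annihilator.hasContinuousCenter hA).isTypeCover_iff h q⟩
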